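/- **Theorem 1.1.** Let $(R,\mathfrak m)$ be a complete local Gorenstein ring (that is, a Noetherian local ring, complete with respect to $\mathfrak m$, of finite injective dimension over itself) with $n=\dim R$, and let $I\subsetneq R$ be an ideal of height $c$. For an ideal $J$ of a Noetherian ring $S$ let $H^i_J$ denote the $i$-th right derived functor of $\Gamma_J(M)=\{x\in M : J^kx=0 \text{ for some } k\}$, and put $\operatorname{cd}J=\sup\{i : H^i_J(S)\ne 0\}$. Assume that $I$ is locally a cohomological complete intersection, i.e. $\operatorname{cd}(IR_{\mathfrak p})=c$ for all prime ideals $\mathfrak p\in V(I)\setminus\{\mathfrak m\}$. Then the following conditions are equivalent: (i) The natural homomorphism $R\to \operatorname{Hom}_R(H^c_I(R),H^c_I(R))$, $r\mapsto (x\mapsto rx)$, is an isomorphism. (ii) $H^i_I(R)=0$ for every $i\in\{n-1,n\}$ with $i>c$. In particular, if $c\le n-2$, then (i) holds if and only if $H^{n-1}_I(R)=H^n_I(R)=0$. -/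

import Mathlib

noncomputable section

open CategoryTheory

universe u

namespace LocCoh

variable {R : Type u} [CommRing R]

/-- The submodule `Γ_I(M)` of those `x : M` that are annihilated by some power of `I`. -/
def gammaSubmodule (I : Ideal R) (M : Type u) [AddCommGroup M] [Module R M] :
    Submodule R M where
  carrier := {x | ∃ k : ℕ, ∀ a ∈ I ^ k, a • x = 0}
  zero_mem' := ⟨0, fun a _ => smul_zero a⟩
  add_mem' := by
    rintro x y ⟨k, hk⟩ ⟨l, hl⟩
    refine ⟨k + l, fun a ha => ?_⟩
    rw [smul_add, hk a (Ideal.pow_le_pow_right (Nat.le_add_right k l) ha),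
      hl a (Ideal.pow_le_pow_right (Nat.le_add_left l k) ha), add_zero]
  smul_mem' := by
    rintro r x ⟨k, hk⟩
    exact ⟨k, fun a ha => by rw [smul_comm, hk a ha, smul_zero]⟩

theorem map_mem_gammaSubmodule (I : Ideal R) {M N : Type u} [AddCommGroup M] [Module R M]
    [AddCommGroup N] [Module R N] (f : M →ₗ[R] N) (x : M) (hx : x ∈ gammaSubmodule I M) :
    f x ∈ gammaSubmodule I N := by
  obtain ⟨k, hk⟩ := hx
  exact ⟨k, fun a ha => by rw [← map_smul, hk a ha, map_zero]⟩

/-- The section functor `Γ_I` on `R`-modules: `M ↦ Γ_I(M)`, a morphism being sent to its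
restriction. -/
def gamma (I : Ideal R) : ModuleCat.{u} R ⥤ ModuleCat.{u} R where
  obj M := ModuleCat.of R (gammaSubmodule I M)
  map f := ModuleCat.ofHom (f.hom.restrict (map_mem_gammaSubmodule I f.hom))

instance gamma_additive (I : Ideal R) : (gamma I).Additive where

/-- The `i`-th local cohomology functor `H^i_I`: the `i`-th right derived functor of `Γ_I`,
so that `H^i_I(M)` is the `i`-th cohomology module of `Γ_I(E)` for an injective resolution
`M → E`. -/
def localCohomologyFunctor (I : Ideal R) (i : ℕ) : ModuleCat.{u} R ⥤ ModuleCat.{u} R :=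
  (gamma I).rightDerived i

/-- The local cohomology module `H^i_I(R)` of the ring `R` itself. -/
abbrev H (I : Ideal R) (i : ℕ) : ModuleCat.{u} R :=
  (localCohomologyFunctor I i).obj (ModuleCat.of R R)

/-- The cohomological dimension `cd I = sup {i | H^i_I(R) ≠ 0}`, with the value `⊥` if all
`H^i_I(R)` vanish. -/
def cohomologicalDimension (I : Ideal R) : WithBot ℕ∞ :=
  sSup {d : WithBot ℕ∞ | ∃ i : ℕ, Nontrivial (H I i) ∧ d = ((i : ℕ∞) : WithBot ℕ∞)}

/-- An ideal `I` of a local ring `(R, 𝔪)` is locally a cohomological complete intersection if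
`cd (I R_𝔭) = height I` for all primes `𝔭 ⊇ I` different from `𝔪`. -/
def IsLocallyCohomologicalCompleteIntersection [IsLocalRing R] (I : Ideal R) : Prop :=
  ∀ (p : Ideal R) [p.IsPrime], I ≤ p → p ≠ IsLocalRing.maximalIdeal R →
    cohomologicalDimension (I.map (algebraMap R (Localization.AtPrime p))) =
      (I.height : WithBot ℕ∞)

variable (R) in
/-- A Noetherian local ring is Gorenstein if it has finite injective dimension as a module
over itself. -/
class IsGorensteinLocalRing : Prop extends IsNoetherianRing R, IsLocalRing R where
  finite_injectiveDimension : ∃ k : ℕ, HasInjectiveDimensionLE (ModuleCat.of R R) k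

end LocCoh

end

/-!
Write `D` for the derived category of `R`-modules, `T` for `R` as an object of `D` in degree `0`,
`A = RΓ_I(R)` with its natural morphism `A ⟶ T`, and `𝔪` for the maximal ideal. Let
`τ ⟶ A ⟶ C ⟶ τ⟦1⟧` be the triangle in which `τ` carries the cohomology of `A` in degrees at most
`c` and `C` the rest. As `R` is Gorenstein, `H^i_I(R) = 0` for `i < c`, so `τ` is `H^c_I(R)` placed
in degree `c`, and endomorphisms of `H^c_I(R)` are endomorphisms of `τ`. The proof compares `R`
with `End(τ)` through two properties of `A ⟶ T`.

* Composition with `A ⟶ T` is a bijection `Hom(K, A) ≃ Hom(K, T)` for every bounded `K` with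
  `I`-torsion cohomology (`BoundedWith.bijective_comp_derivedGammaToSelf`): an injective resolution
  `E` of `R` has the termwise injective subcomplex `Γ_I(E)`, and the termwise injective quotient
  `E / Γ_I(E)` has no `I`-torsion. Hence `End(τ) = Hom(τ, A) = Hom(τ, T)`.
* Composition with `A ⟶ T` is a bijection `Hom(T, V) ≃ Hom(A, V)` for `V = T` and `V = T⟦1⟧`
  (`bijective_precomp_derivedGammaToSelf`). Adding the generators of `I` one at a time, the
  cones that occur have cohomology on which some `x ∈ 𝔪` is invertible. Over a complete local
  ring such modules have no `Ext` into `R` (`extVanishes_of_bijective_smul`): in degrees `0` and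
  `1` this follows by summing series in powers of `x`, and a telescope resolution reduces the higher
  degrees to it. Hence `R = Hom(T, T) = Hom(A, T)` and `Hom(A⟦-1⟧, T) = Hom(T, T⟦1⟧) = 0`.

So `R ⟶ End(H^c_I(R))` is bijective if and only if `Hom(A, T) ⟶ Hom(τ, T)` is
(`bijective_algebraMap_iff`). Since also `Hom(τ⟦1⟧, T) = Hom(τ⟦1⟧, A) = 0` for degree reasons, the
triangle shows that this holds if and only if `Hom(C, T) = 0 = Hom(C⟦-1⟧, T)`. The condition on the
punctured spectrum ensures that the cohomology of `C` is `𝔪`-torsion, and then a weak form of local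
duality applies: an `𝔪`-torsion `N ≠ 0` contains the residue field `k`, and `Ext^j(k, R)` is
nonzero exactly for `j = n` while `R` has injective dimension `n`
(`extVanishes_residueField_iff_ne`, `extVanishes_of_dim_lt`), so `Ext^n(N, R) ≠ 0`. Therefore
bounded `𝔪`-torsion objects in degrees less than `n` have no morphisms to `T`, whereas those in
degrees at most `n` without morphisms to `T` have no cohomology in degree `n`
(`BoundedWith.hom_self_eq_zero_of_isLE`, `BoundedWith.isLE_of_forall_hom_self_eq_zero`). Applied to
`C` and then to `C⟦-1⟧`, this turns the two vanishing conditions into `H^n(C) = 0 = H^{n-1}(C)`,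
which is the vanishing of `H^n_I(R)` and `H^{n-1}_I(R)` in degrees above `c`.
-/

open CategoryTheory Abelian IsLocalRing

universe w v u

/-! ### Vanishing of `Ext` -/

namespace LocCoh

variable {R : Type u} [CommRing R]

variable (R) in
/-- `ExtVanishes R M N j` states that `Ext^j_R(M, N) = 0`. -/
def ExtVanishes (M N : Type u) [AddCommGroup M] [Module R M] [AddCommGroup N] [Module R N]
    (j : ℕ) : Prop :=
  Subsingleton (Ext (ModuleCat.of R M) (ModuleCat.of R N) j)

section LongExactSequences

variable {M N M₁ M₂ M₃ N₁ N₂ N₃ : Type u} [AddCommGroup M] [Module R M]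
  [AddCommGroup N] [Module R N]
  [AddCommGroup M₁] [Module R M₁] [AddCommGroup M₂] [Module R M₂] [AddCommGroup M₃] [Module R M₃]
  [AddCommGroup N₁] [Module R N₁] [AddCommGroup N₂] [Module R N₂] [AddCommGroup N₃] [Module R N₃]

theorem extVanishes_iff_forall_eq_zero {j : ℕ} : ExtVanishes R M N j ↔
    ∀ x : Ext (ModuleCat.of R M) (ModuleCat.of R N) j, x = 0 :=
  ⟨fun h x => h.elim _ _, fun h => ⟨fun x y => by rw [h x, h y]⟩⟩

/-- The short exact sequence in `ModuleCat R` given by an exact pair of linear maps. -/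
def shortComplexOfExact (f : M₁ →ₗ[R] M₂) (g : M₂ →ₗ[R] M₃) (h : Function.Exact f g) :
    ShortComplex (ModuleCat.{u} R) :=
  ShortComplex.mk (ModuleCat.ofHom f) (ModuleCat.ofHom g) (by
    ext x; exact h.apply_apply_eq_zero x)

theorem shortComplexOfExact_shortExact {f : M₁ →ₗ[R] M₂} {g : M₂ →ₗ[R] M₃}
    (hf : Function.Injective f) (hg : Function.Surjective g) (h : Function.Exact f g) :
    (shortComplexOfExact f g h).ShortExact where
  exact := (ShortComplex.ShortExact.moduleCat_exact_iff_function_exact _).mpr h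
  mono_f := (ModuleCat.mono_iff_injective _).mpr hf
  epi_g := (ModuleCat.epi_iff_surjective _).mpr hg

section Contravariant

variable {f : M₁ →ₗ[R] M₂} {g : M₂ →ₗ[R] M₃} (hf : Function.Injective f)
  (hg : Function.Surjective g) (h : Function.Exact f g)

include hf hg h

theorem ExtVanishes.source_middle {j : ℕ} (h₁ : ExtVanishes R M₁ N j) (h₃ : ExtVanishes R M₃ N j) :
    ExtVanishes R M₂ N j := by
  rw [extVanishes_iff_forall_eq_zero] at *
  intro x
  obtain ⟨y, rfl⟩ := Ext.contravariant_sequence_exact₂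
    (shortComplexOfExact_shortExact hf hg h) (ModuleCat.of R N) x (h₁ _)
  rw [show y = 0 from h₃ y]
  exact Ext.comp_zero ..

theorem ExtVanishes.source_right {j : ℕ} (h₁ : ExtVanishes R M₁ N j)
    (h₂ : ExtVanishes R M₂ N (j + 1)) : ExtVanishes R M₃ N (j + 1) := by
  rw [extVanishes_iff_forall_eq_zero] at *
  intro x
  obtain ⟨y, rfl⟩ := Ext.contravariant_sequence_exact₃
    (shortComplexOfExact_shortExact hf hg h) (ModuleCat.of R N) x (h₂ _) (add_comm 1 j)
  rw [show y = 0 from h₁ y]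
  exact Ext.comp_zero ..

theorem ExtVanishes.source_left {j : ℕ} (h₂ : ExtVanishes R M₂ N j)
    (h₃ : ExtVanishes R M₃ N (j + 1)) : ExtVanishes R M₁ N j := by
  rw [extVanishes_iff_forall_eq_zero] at *
  intro x
  obtain ⟨y, rfl⟩ := Ext.contravariant_sequence_exact₁
    (shortComplexOfExact_shortExact hf hg h) (ModuleCat.of R N) x (add_comm 1 j) (h₃ _)
  rw [show y = 0 from h₂ y]
  exact Ext.comp_zero ..

end Contravariant

section Covariant

variable {f : N₁ →ₗ[R] N₂} {g : N₂ →ₗ[R] N₃} (hf : Function.Injective f)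
  (hg : Function.Surjective g) (h : Function.Exact f g)

include hf hg h

theorem ExtVanishes.target_left {j : ℕ} (h₃ : ExtVanishes R M N₃ j)
    (h₂ : ExtVanishes R M N₂ (j + 1)) : ExtVanishes R M N₁ (j + 1) := by
  rw [extVanishes_iff_forall_eq_zero] at *
  intro x
  obtain ⟨y, rfl⟩ := Ext.covariant_sequence_exact₁ (ModuleCat.of R M)
    (shortComplexOfExact_shortExact hf hg h) x (h₂ _) rfl
  rw [show y = 0 from h₃ y]
  exact Ext.zero_comp ..

theorem ExtVanishes.target_right {j : ℕ} (h₂ : ExtVanishes R M N₂ j)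
    (h₁ : ExtVanishes R M N₁ (j + 1)) : ExtVanishes R M N₃ j := by
  rw [extVanishes_iff_forall_eq_zero] at *
  intro x
  obtain ⟨y, rfl⟩ := Ext.covariant_sequence_exact₃ (ModuleCat.of R M)
    (shortComplexOfExact_shortExact hf hg h) x rfl (h₁ _)
  rw [show y = 0 from h₂ y]
  exact Ext.zero_comp ..

end Covariant

theorem ExtVanishes.of_linearEquiv {j : ℕ} (e : M₁ ≃ₗ[R] M₂) (h : ExtVanishes R M₁ N j) :
    ExtVanishes R M₂ N j := by
  rw [extVanishes_iff_forall_eq_zero] at *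
  intro x
  have : x = (Ext.mk₀ (ModuleCat.ofHom e.symm.toLinearMap)).comp
      ((Ext.mk₀ (ModuleCat.ofHom e.toLinearMap)).comp x (zero_add j)) (zero_add j) := by
    rw [Ext.mk₀_comp_mk₀_assoc, ← ModuleCat.ofHom_comp]
    simp [Ext.mk₀_id_comp]
  rw [this, h ((Ext.mk₀ (ModuleCat.ofHom e.toLinearMap)).comp x (zero_add j)), Ext.comp_zero]

theorem extVanishes_of_subsingleton [Subsingleton M] (j : ℕ) : ExtVanishes R M N j := by
  rw [extVanishes_iff_forall_eq_zero]
  intro x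
  have : 𝟙 (ModuleCat.of R M) = 0 := by
    ext y; exact Subsingleton.elim (α := M) _ _
  rw [← x.mk₀_id_comp, this, Ext.mk₀_zero, Ext.zero_comp]

theorem extVanishes_zero_iff : ExtVanishes R M N 0 ↔ Subsingleton (M →ₗ[R] N) :=
  ((Ext.linearEquiv₀ (R := R)).trans ModuleCat.homLinearEquiv).toEquiv.subsingleton_congr

theorem extVanishes_of_projective [Module.Projective R M] (j : ℕ) : ExtVanishes R M N (j + 1) := by
  rw [extVanishes_iff_forall_eq_zero]
  intro x
  have : Projective (ModuleCat.of R M) :=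
    (IsProjective.iff_projective (R := R) M).mp inferInstance
  exact x.eq_zero_of_projective

theorem extVanishes_of_injective [Module.Injective R N] (j : ℕ) : ExtVanishes R M N (j + 1) := by
  rw [extVanishes_iff_forall_eq_zero]
  intro x
  have : Injective (ModuleCat.of R N) := by
    rw [← Module.injective_iff_injective_object]; infer_instance
  exact x.eq_zero_of_injective

/-- Multiplication by `r` on `Ext` can be computed on either argument. -/
theorem Ext.comp_mk₀_smul_id_eq_zero {r : R} (hr : ∀ m : M, r • m = 0) {j : ℕ}
    (x : Ext (ModuleCat.of R M) (ModuleCat.of R N) j) :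
    x.comp (Ext.mk₀ (r • 𝟙 (ModuleCat.of R N))) (add_zero j) = 0 := by
  have h0 : r • 𝟙 (ModuleCat.of R M) = 0 := by
    ext m; exact hr m
  have h1 : r • x = 0 := by
    rw [← x.mk₀_id_comp, ← Ext.smul_comp, ← Ext.mk₀_smul, h0, Ext.mk₀_zero, Ext.zero_comp]
  rw [Ext.mk₀_smul, Ext.comp_smul, Ext.comp_mk₀_id, h1]

/-- If `r` annihilates the first argument, then multiplication by `r` on the second one induces
the zero map, so a regular element shifts `Ext` by one degree. -/
theorem ExtVanishes.target_left_of_smul {r : R} (hr : ∀ m : M, r • m = 0)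
    {f : N →ₗ[R] N} {g : N →ₗ[R] N₃} (hf : Function.Injective f) (hg : Function.Surjective g)
    (h : Function.Exact f g) (hfr : ∀ x, f x = r • x) {j : ℕ} (h₃ : ExtVanishes R M N₃ j) :
    ExtVanishes R M N (j + 1) := by
  rw [extVanishes_iff_forall_eq_zero] at *
  intro x
  have hf' : ModuleCat.ofHom f = r • 𝟙 (ModuleCat.of R N) := by
    ext y; exact hfr y
  obtain ⟨y, rfl⟩ := Ext.covariant_sequence_exact₁ (ModuleCat.of R M)
    (shortComplexOfExact_shortExact hf hg h) x (by
      change x.comp (Ext.mk₀ (ModuleCat.ofHom f)) _ = 0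
      rw [hf', Ext.comp_mk₀_smul_id_eq_zero hr]) rfl
  rw [show y = 0 from h₃ y]
  exact Ext.zero_comp ..

/-- A consequence of Nakayama's lemma: if `y ∈ 𝔪` is a nonzerodivisor on the finite module `M`
and `Ext^{j+1}(M/yM, N) = 0`, then multiplication by `y` is surjective on the finite module
`Ext^j(M, N)`, which therefore vanishes. -/
theorem ExtVanishes.of_smul_regular [IsNoetherianRing R] [IsLocalRing R]
    [Module.Finite R M] [Module.Finite R N] {y : R} (hy : y ∈ maximalIdeal R)
    {f : M →ₗ[R] M} {g : M →ₗ[R] M₃} (hf : Function.Injective f) (hg : Function.Surjective g)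
    (h : Function.Exact f g) (hfy : ∀ x, f x = y • x) {j : ℕ}
    (h₃ : ExtVanishes R M₃ N (j + 1)) : ExtVanishes R M N j := by
  have hf' : ModuleCat.ofHom f = y • 𝟙 (ModuleCat.of R M) := by
    ext z; exact hfy z
  rw [extVanishes_iff_forall_eq_zero] at h₃
  have key : (⊤ : Submodule R (Ext (ModuleCat.of R M) (ModuleCat.of R N) j)) ≤
      maximalIdeal R • ⊤ := by
    intro x _
    obtain ⟨z, rfl⟩ := Ext.contravariant_sequence_exact₁
      (shortComplexOfExact_shortExact hf hg h) (ModuleCat.of R N) x (add_comm 1 j) (h₃ _)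
    have hz (z : Ext (ModuleCat.of R M) (ModuleCat.of R N) j) :
        (Ext.mk₀ (ModuleCat.ofHom f)).comp z (zero_add j) = y • z := by
      rw [hf', Ext.mk₀_smul, Ext.smul_comp, Ext.mk₀_id_comp]
    exact (hz z).symm ▸ Submodule.smul_mem_smul hy trivial
  have hbot := Submodule.eq_bot_of_le_smul_of_le_jacobson_bot (maximalIdeal R) _
    (Module.finite_def.mp inferInstance) key
    (IsLocalRing.jacobson_eq_maximalIdeal ⊥ bot_ne_top).ge
  exact (Submodule.subsingleton_iff R).mp (subsingleton_of_bot_eq_top hbot.symm)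

end LongExactSequences

end LocCoh

/-! ### Bass' lemma, Ischebeck's theorem and maximal regular sequences -/

namespace LocCoh

variable {R : Type u} [CommRing R]

theorem ExtVanishes.of_linearEquiv_target {M N₁ N₂ : Type u} [AddCommGroup M] [Module R M]
    [AddCommGroup N₁] [Module R N₁] [AddCommGroup N₂] [Module R N₂] {j : ℕ} (e : N₁ ≃ₗ[R] N₂)
    (h : ExtVanishes R M N₁ j) : ExtVanishes R M N₂ j := by
  rw [extVanishes_iff_forall_eq_zero] at *
  intro x
  have : x = (x.comp (Ext.mk₀ (ModuleCat.ofHom e.symm.toLinearMap)) (add_zero j)).comp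
      (Ext.mk₀ (ModuleCat.ofHom e.toLinearMap)) (add_zero j) := by
    rw [Ext.comp_assoc_of_third_deg_zero, Ext.mk₀_comp_mk₀, ← ModuleCat.ofHom_comp]
    simp [Ext.comp_mk₀_id]
  rw [this, h (x.comp (Ext.mk₀ (ModuleCat.ofHom e.symm.toLinearMap)) (add_zero j)), Ext.zero_comp]

section QuotientSequence

variable (a : Ideal R) (x : R)

theorem injective_lsmul_quotient_of_isSMulRegular (hx : IsSMulRegular (R ⧸ a) x) :
    Function.Injective (LinearMap.lsmul R (R ⧸ a) x) := hx

theorem exact_lsmul_quotient_factor :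
    Function.Exact (LinearMap.lsmul R (R ⧸ a) x)
      (Submodule.factor (le_sup_left : a ≤ a ⊔ Ideal.span {x})) := by
  intro y
  obtain ⟨r, rfl⟩ := Submodule.Quotient.mk_surjective _ y
  constructor
  · intro h
    have h' : r ∈ a ⊔ Ideal.span {x} := (Submodule.Quotient.mk_eq_zero _).mp h
    obtain ⟨s, hs, z, hz, rfl⟩ := Submodule.mem_sup.mp h'
    obtain ⟨w, rfl⟩ := Ideal.mem_span_singleton'.mp hz
    refine ⟨Submodule.Quotient.mk w, ?_⟩
    rw [LinearMap.lsmul_apply, ← Submodule.Quotient.mk_smul, Submodule.Quotient.eq, smul_eq_mul]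
    convert a.neg_mem hs using 1
    ring
  · rintro ⟨z, hz⟩
    obtain ⟨w, rfl⟩ := Submodule.Quotient.mk_surjective _ z
    rw [← hz, LinearMap.lsmul_apply, ← Submodule.Quotient.mk_smul]
    refine (Submodule.Quotient.mk_eq_zero _).mpr ?_
    exact Ideal.mem_sup_right (Ideal.mem_span_singleton'.mpr ⟨w, mul_comm w x⟩)

end QuotientSequence

/-- Dévissage along a prime filtration. -/
theorem extVanishes_of_forall_isPrime [IsNoetherianRing R] {N : Type u} [AddCommGroup N]
    [Module R N] {j : ℕ} (a : Ideal R)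
    (h : ∀ p : Ideal R, p.IsPrime → a ≤ p → ExtVanishes R (R ⧸ p) N j)
    (M : Type u) [AddCommGroup M] [Module R M] [hM : Module.Finite R M]
    (ha : ∀ r ∈ a, ∀ m : M, r • m = 0) : ExtVanishes R M N j := by
  revert ha
  refine IsNoetherianRing.induction_on_isQuotientEquivQuotientPrime R hM
    (motive := fun M _ _ _ => (∀ r ∈ a, ∀ m : M, r • m = 0) → ExtVanishes R M N j) ?_ ?_ ?_
  · intro M _ _ _ _ _
    exact extVanishes_of_subsingleton j
  · intro M _ _ _ p e ha
    refine (h p.1 p.2 fun r hr => ?_).of_linearEquiv e.symm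
    rw [← Ideal.Quotient.eq_zero_iff_mem]
    have := congrArg e (ha r hr (e.symm 1))
    rwa [map_smul, e.apply_symm_apply, map_zero, Algebra.smul_def, mul_one] at this
  · intro M₁ _ _ _ M₂ _ _ _ M₃ _ _ _ f g hf hg hfg h₁ h₃ ha
    refine ExtVanishes.source_middle hf hg hfg (h₁ fun r hr m => hf ?_) (h₃ fun r hr m => ?_)
    · rw [map_smul, ha r hr, map_zero]
    · obtain ⟨m, rfl⟩ := hg m
      rw [← map_smul, ha r hr, map_zero]

theorem wellFoundedGT_primeSpectrum [IsNoetherianRing R] : WellFoundedGT (PrimeSpectrum R) :=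
  StrictMono.wellFoundedGT (f := PrimeSpectrum.asIdeal) fun _ _ h => h

section Local

variable [IsNoetherianRing R] [IsLocalRing R]

/-- Bass' lemma: if `Ext^{j+1}(R/q, N)` vanishes for all primes `q` strictly containing the
non-maximal prime `p`, then `Ext^j(R/p, N) = 0`. -/
theorem extVanishes_quotient_of_forall_lt {N : Type u} [AddCommGroup N] [Module R N]
    [Module.Finite R N] {j : ℕ} (p : Ideal R) [hp : p.IsPrime] (hpm : p ≠ maximalIdeal R)
    (h : ∀ q : Ideal R, q.IsPrime → p < q → ExtVanishes R (R ⧸ q) N (j + 1)) :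
    ExtVanishes R (R ⧸ p) N j := by
  obtain ⟨y, hym, hyp⟩ := SetLike.exists_of_lt (lt_of_le_of_ne (le_maximalIdeal hp.ne_top) hpm)
  have hreg : IsSMulRegular (R ⧸ p) y := by
    rw [isSMulRegular_iff_right_eq_zero_of_smul]
    intro z hz
    rw [Algebra.smul_def, mul_eq_zero] at hz
    exact hz.resolve_left fun h0 => hyp (Ideal.Quotient.eq_zero_iff_mem.mp h0)
  refine ExtVanishes.of_smul_regular hym
    (injective_lsmul_quotient_of_isSMulRegular p y hreg) (Submodule.factor_surjective le_sup_left)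
    (exact_lsmul_quotient_factor p y) (fun _ => rfl) ?_
  refine extVanishes_of_forall_isPrime (p ⊔ Ideal.span {y}) (fun q hq hle => h q hq ?_) _ ?_
  · refine lt_of_le_of_ne (le_sup_left.trans hle) ?_
    rintro rfl
    exact hyp (hle (Ideal.mem_sup_right (Ideal.mem_span_singleton_self y)))
  · intro r hr m
    obtain ⟨m, rfl⟩ := Submodule.Quotient.mk_surjective _ m
    exact (Submodule.Quotient.mk_eq_zero _).mpr (Ideal.mul_mem_right _ _ hr)

/-- Ischebeck's theorem for `R/p`. -/
theorem extVanishes_quotient_of_add_coheight_lt {N : Type u} [AddCommGroup N] [Module R N]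
    [Module.Finite R N] {t : ℕ} (h : ∀ j < t, ExtVanishes R (R ⧸ maximalIdeal R) N j)
    (p : PrimeSpectrum R) (j : ℕ) (hj : (j : ℕ∞) + Order.coheight p < t) :
    ExtVanishes R (R ⧸ p.asIdeal) N j := by
  have := wellFoundedGT_primeSpectrum (R := R)
  induction p using WellFoundedGT.induction generalizing j with
  | _ p ih =>
    by_cases hpm : p.asIdeal = maximalIdeal R
    · rw [hpm]
      exact h j (by exact_mod_cast lt_of_le_of_lt le_self_add hj)
    · have := p.2
      refine extVanishes_quotient_of_forall_lt p.asIdeal hpm fun q hq hlt => ?_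
      refine ih ⟨q, hq⟩ hlt (j + 1) (lt_of_le_of_lt ?_ hj)
      have := Order.coheight_add_one_le (show p < ⟨q, hq⟩ from hlt)
      calc ((j + 1 : ℕ) : ℕ∞) + Order.coheight (⟨q, hq⟩ : PrimeSpectrum R)
          = j + (Order.coheight (⟨q, hq⟩ : PrimeSpectrum R) + 1) := by push_cast; ring
        _ ≤ _ := by gcongr

/-- If `Ext(k, N)` vanishes above degree `d`, then so does `Ext(M, N)` for all finite `M`. -/
theorem extVanishes_of_finite_of_lt {N : Type u} [AddCommGroup N] [Module R N]
    [Module.Finite R N] {d : ℕ} (h : ∀ j > d, ExtVanishes R (R ⧸ maximalIdeal R) N j)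
    (M : Type u) [AddCommGroup M] [Module R M] [Module.Finite R M] (j : ℕ) (hj : d < j) :
    ExtVanishes R M N j := by
  have key (p : PrimeSpectrum R) (j : ℕ) (hj : d < j) : ExtVanishes R (R ⧸ p.asIdeal) N j := by
    have := wellFoundedGT_primeSpectrum (R := R)
    induction p using WellFoundedGT.induction generalizing j with
    | _ p ih =>
      by_cases hpm : p.asIdeal = maximalIdeal R
      · rw [hpm]
        exact h j hj
      · have := p.2
        exact extVanishes_quotient_of_forall_lt p.asIdeal hpm fun q hq hlt =>
          ih ⟨q, hq⟩ hlt (j + 1) (by omega)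
  exact extVanishes_of_forall_isPrime ⊥ (fun p hp _ => key ⟨p, hp⟩ j hj) M
    fun r hr m => by rw [(Submodule.mem_bot R).mp hr, zero_smul]

/-- A maximal regular sequence on `R/a`, recorded through the quotient `R/b` by it: `b` is
generated by `a` and `i` further elements, `R/b` has a nonzero socle, and `Ext` into or out of
`R/a` is compared with `R/b` by shifting degrees `i` times. -/
theorem exists_quotient_by_maximal_regular_sequence (a : Ideal R) (ha : a ≠ ⊤) :
    ∃ (i : ℕ) (b : Ideal R) (s : Finset R), a ≤ b ∧ b ≠ ⊤ ∧ b = a ⊔ Ideal.span (s : Set R) ∧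
      s.card ≤ i ∧ Nontrivial ((R ⧸ maximalIdeal R) →ₗ[R] R ⧸ b) ∧
      (∀ l : ℕ, (∀ j > l, ExtVanishes R (R ⧸ a) R j) →
        ∀ j > l + i, ExtVanishes R (R ⧸ b) R j) ∧
      ∀ (N : Type u) [AddCommGroup N] [Module R N], (∀ r ∈ b, ∀ m : N, r • m = 0) →
        (∀ j < i, ExtVanishes R N (R ⧸ a) j) ∧
        (ExtVanishes R N (R ⧸ a) i → Subsingleton (N →ₗ[R] R ⧸ b)) := by
  classical
  induction a using WellFoundedGT.induction with
  | _ a ih =>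
    by_cases hs : Subsingleton ((R ⧸ maximalIdeal R) →ₗ[R] R ⧸ a)
    · obtain ⟨x, hx, hreg⟩ := IsSMulRegular.subsingleton_linearMap_iff.mp hs
      have hxm : x ∈ maximalIdeal R := by simpa [Ideal.annihilator_quotient] using hx
      have hxa : x ∉ a := fun hxa => by
        have h1 : (1 : R ⧸ a) = 0 := hreg (by
          change x • (1 : R ⧸ a) = x • 0
          rw [smul_zero, Algebra.smul_def, mul_one]
          exact Ideal.Quotient.eq_zero_iff_mem.mpr hxa)
        exact ha ((Ideal.eq_top_iff_one a).mpr (Ideal.Quotient.eq_zero_iff_mem.mp h1))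
      have hlt : a < a ⊔ Ideal.span {x} := left_lt_sup.mpr fun hle =>
        hxa (hle (Ideal.mem_span_singleton_self x))
      have hne : a ⊔ Ideal.span {x} ≠ ⊤ := fun htop => by
        have : a ⊔ Ideal.span {x} ≤ maximalIdeal R := sup_le (le_maximalIdeal ha)
          ((Ideal.span_singleton_le_iff_mem _).mpr hxm)
        exact (Ideal.IsMaximal.ne_top inferInstance) (top_le_iff.mp (htop ▸ this))
      obtain ⟨i, b, s, hab, hb, hbs, hsi, hsoc, hup, hdown⟩ := ih _ hlt hne
      have hinj := injective_lsmul_quotient_of_isSMulRegular a x hreg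
      have hsurj := Submodule.factor_surjective (le_sup_left : a ≤ a ⊔ Ideal.span {x})
      have hex := exact_lsmul_quotient_factor a x
      refine ⟨i + 1, b, insert x s, le_sup_left.trans hab, hb, ?_, ?_, hsoc, ?_, ?_⟩
      · rw [hbs, Finset.coe_insert, Ideal.span_insert, sup_assoc]
      · exact (Finset.card_insert_le _ _).trans (by omega)
      · intro l hl j hj
        refine hup (l + 1) (fun k hk => ?_) j (by omega)
        obtain ⟨k, rfl⟩ : ∃ k', k = k' + 1 := ⟨k - 1, by omega⟩
        exact ExtVanishes.source_right hinj hsurj hex (hl k (by omega)) (hl (k + 1) (by omega))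
      · intro N _ _ hN
        obtain ⟨hlow, htop⟩ := hdown N hN
        have hxN : ∀ m : N, x • m = 0 :=
          hN x (hab (Ideal.mem_sup_right (Ideal.mem_span_singleton_self x)))
        have hlow' : ∀ j < i + 1, ExtVanishes R N (R ⧸ a) j := by
          rintro (_ | j) hj
          · rw [extVanishes_zero_iff]
            exact IsSMulRegular.linearMap_subsingleton_of_mem_annihilator hreg
              (Module.mem_annihilator.mpr hxN)
          · exact ExtVanishes.target_left_of_smul hxN hinj hsurj hex (fun _ => rfl)
              (hlow j (by omega))
        exact ⟨hlow', fun h => htop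
          (ExtVanishes.target_right hinj hsurj hex (hlow' i (by omega)) h)⟩
    · refine ⟨0, a, ∅, le_rfl, ha, by simp, by simp, not_subsingleton_iff_nontrivial.mp hs,
        fun l hl j hj => hl j (by simpa using hj), fun N _ _ _ => ⟨by simp, fun h => ?_⟩⟩
      exact extVanishes_zero_iff.mp h

end Local

end LocCoh

/-! ### `Ext` into a Gorenstein local ring -/

namespace LocCoh

variable {R : Type u} [CommRing R]

section Baer

variable (R) in
theorem exists_embedding_in_injective (N : Type u) [AddCommGroup N] [Module R N] :
    ∃ (Q : ModuleCat.{u} R) (f : N →ₗ[R] Q), Module.Injective R Q ∧ Function.Injective f := by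
  refine ⟨Injective.under (ModuleCat.of R N), (Injective.ι (ModuleCat.of R N)).hom, ?_, ?_⟩
  · rw [Module.injective_iff_injective_object]
    exact inferInstanceAs (Injective (Injective.under (ModuleCat.of R N)))
  · exact (ModuleCat.mono_iff_injective _).mp inferInstance

theorem baer_of_extVanishes_one {N : Type u} [AddCommGroup N] [Module R N]
    (h : ∀ a : Ideal R, ExtVanishes R (R ⧸ a) N 1) : Module.Baer R N := by
  intro a f
  have hS := shortComplexOfExact_shortExact (f := a.subtype) (g := a.mkQ)
    a.injective_subtype a.mkQ_surjective (LinearMap.exact_subtype_mkQ a)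
  obtain ⟨y, hy⟩ := Ext.contravariant_sequence_exact₁ hS (ModuleCat.of R N)
    (Ext.mk₀ (ModuleCat.ofHom f)) (add_comm 1 0)
    (extVanishes_iff_forall_eq_zero.mp (h a) _)
  obtain ⟨g, rfl⟩ := (Ext.mk₀_bijective (ModuleCat.of R R) (ModuleCat.of R N)).surjective y
  have hg : ModuleCat.ofHom a.subtype ≫ g = ModuleCat.ofHom f := by
    apply (Ext.mk₀_bijective _ _).injective
    rw [← Ext.mk₀_comp_mk₀]
    exact hy
  refine ⟨g.hom, fun x hx => ?_⟩
  exact congrArg (fun φ : ModuleCat.of R a ⟶ ModuleCat.of R N => φ.hom ⟨x, hx⟩) hg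

/-- Baer's criterion in higher degrees. -/
theorem extVanishes_of_forall_ideal {N : Type u} [AddCommGroup N] [Module R N] {j : ℕ}
    (h : ∀ a : Ideal R, ExtVanishes R (R ⧸ a) N (j + 1)) (M : Type u) [AddCommGroup M]
    [Module R M] : ExtVanishes R M N (j + 1) := by
  induction j generalizing N with
  | zero =>
    have := Module.Baer.injective (baer_of_extVanishes_one h)
    exact extVanishes_of_injective 0
  | succ j ih =>
    obtain ⟨Q, f, hQ, hf⟩ := exists_embedding_in_injective R N
    have hg := (LinearMap.range f).mkQ_surjective
    have hfg : Function.Exact f (LinearMap.range f).mkQ := LinearMap.exact_map_mkQ_range f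
    have h3 : ExtVanishes R M (Q ⧸ LinearMap.range f) (j + 1) :=
      ih fun a => ExtVanishes.target_right hf hg hfg (extVanishes_of_injective j) (h a)
    exact ExtVanishes.target_left hf hg hfg h3 (extVanishes_of_injective (j + 1))

end Baer

section Gorenstein

variable [IsNoetherianRing R] [IsLocalRing R] {n : ℕ}

/-- For a Noetherian local ring `R` of finite self-injective dimension, the only degree in which
`Ext(k, R)` does not vanish is `dim R`. -/
theorem extVanishes_residueField_iff (hn : ringKrullDim R = n)
    (hfin : ∃ D : ℕ, ∀ j > D, ExtVanishes R (R ⧸ maximalIdeal R) R j) (j : ℕ) :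
    ExtVanishes R (R ⧸ maximalIdeal R) R j ↔ j ≠ n := by
  obtain ⟨i, b, s, -, hb, hbs, hsi, hsoc, hup, hdown⟩ :=
    exists_quotient_by_maximal_regular_sequence (⊥ : Ideal R) bot_ne_top
  let e : (R ⧸ (⊥ : Ideal R)) ≃ₗ[R] R := Submodule.quotEquivOfEqBot ⊥ rfl
  have hbm : b ≤ maximalIdeal R := le_maximalIdeal hb
  have hk : ∀ r ∈ b, ∀ z : R ⧸ maximalIdeal R, r • z = 0 := fun r hr z => by
    rw [Algebra.smul_def, Ideal.Quotient.algebraMap_eq, Ideal.Quotient.eq_zero_iff_mem.mpr (hbm hr),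
      zero_mul]
  have hlow : ∀ j < i, ExtVanishes R (R ⧸ maximalIdeal R) R j := fun j hj =>
    ((hdown _ hk).1 j hj).of_linearEquiv_target e
  have hi : ¬ ExtVanishes R (R ⧸ maximalIdeal R) R i := fun h =>
    not_subsingleton_iff_nontrivial.mpr hsoc
      ((hdown _ hk).2 (h.of_linearEquiv_target e.symm))
  -- the largest degree `d` with `Ext^d(k, R) ≠ 0` is `i`, as `k` embeds into `R/b`
  have hhigh : ∀ j > i, ExtVanishes R (R ⧸ maximalIdeal R) R j := by
    obtain ⟨D, hD⟩ := hfin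
    by_contra! hcon
    obtain ⟨j, hj, hjv⟩ := hcon
    classical
    let P : ℕ → Prop := fun j => ¬ ExtVanishes R (R ⧸ maximalIdeal R) R j
    have hjD : j ≤ D := by
      by_contra! h
      exact hjv (hD j h)
    let d := Nat.findGreatest P D
    have hd : P d := Nat.findGreatest_spec (P := P) hjD hjv
    have hdi : i < d := lt_of_lt_of_le hj (Nat.le_findGreatest hjD hjv)
    have hgt : ∀ k > d, ExtVanishes R (R ⧸ maximalIdeal R) R k := fun k hk => by
      by_contra h
      by_cases hkD : k ≤ D
      · exact Nat.findGreatest_is_greatest hk hkD h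
      · exact h (hD k (not_le.mp hkD))
    obtain ⟨f, hf⟩ := exists_ne (0 : (R ⧸ maximalIdeal R) →ₗ[R] R ⧸ b)
    have hfinj : Function.Injective f := by
      have : IsSimpleModule R (R ⧸ maximalIdeal R) :=
        isSimpleModule_iff_isCoatom.mpr (IsLocalRing.maximalIdeal.isMaximal R).out
      exact (LinearMap.injective_or_eq_zero f).resolve_right hf
    refine hd (ExtVanishes.source_left hfinj (LinearMap.range f).mkQ_surjective
      (LinearMap.exact_map_mkQ_range f) ?_
      (extVanishes_of_finite_of_lt hgt _ (d + 1) (Nat.lt_succ_self d)))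
    refine hup 0 (fun j hj => ?_) d (by omega)
    obtain ⟨j, rfl⟩ : ∃ j', j = j' + 1 := ⟨j - 1, by omega⟩
    exact (extVanishes_of_projective j).of_linearEquiv e.symm
  have hall (p : Ideal R) (j : ℕ) (hj : i < j) : ExtVanishes R (R ⧸ p) R j :=
    extVanishes_of_finite_of_lt hhigh _ j hj
  -- the maximal ideal is minimal over `b`, so Krull's height theorem bounds `dim R` by `i`
  have hni : n ≤ i := by
    have hmin : maximalIdeal R ∈ (Ideal.span (s : Set R)).minimalPrimes := by
      have hbs' : b = Ideal.span (s : Set R) := by rw [hbs, bot_sup_eq]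
      rw [← hbs']
      obtain ⟨q, hq, hqm⟩ := Ideal.exists_minimalPrimes_le hbm
      have hqp : q.IsPrime := hq.1.1
      have hass : q ∈ associatedPrimes R (R ⧸ b) := by
        apply Module.associatedPrimes.minimalPrimes_annihilator_subset_associatedPrimes
        rwa [Ideal.annihilator_quotient]
      have hqm' : q = maximalIdeal R := by
        by_contra hne
        have h0 := extVanishes_quotient_of_forall_lt (N := R) (j := i) q hne
          fun q' _ _ => hall q' (i + 1) (Nat.lt_succ_self i)
        have hsub := (hdown (R ⧸ q) (fun r hr z => by
          rw [Algebra.smul_def, Ideal.Quotient.algebraMap_eq,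
            Ideal.Quotient.eq_zero_iff_mem.mpr (hq.1.2 hr), zero_mul])).2
            (h0.of_linearEquiv_target e.symm)
        obtain ⟨f, hf⟩ := (isAssociatedPrime_iff_exists_injective_linearMap _ _).mp
          (AssociatedPrimes.mem_iff.mp hass) |>.2
        have hf0 : f = 0 := Subsingleton.elim _ _
        have h1 : (1 : R ⧸ q) = 0 := hf (by rw [hf0]; rfl)
        exact hqp.ne_top ((Ideal.eq_top_iff_one q).mpr (Ideal.Quotient.eq_zero_iff_mem.mp h1))
      exact hqm' ▸ hq
    have h1 := Ideal.height_le_card_of_mem_minimalPrimes_span_finset hmin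
    have h2 := IsLocalRing.maximalIdeal_height_eq_ringKrullDim (R := R)
    rw [hn] at h2
    have h3 : (maximalIdeal R).height = (n : ℕ∞) := by exact_mod_cast h2
    rw [h3] at h1
    have h4 : n ≤ s.card := by exact_mod_cast h1
    exact h4.trans hsi
  have hin : i ≤ n := by
    by_contra! hlt
    have h0 : ExtVanishes R R R 0 := by
      refine extVanishes_of_forall_isPrime ⊥ (fun p hp _ => ?_) R
        fun r hr m => by rw [(Submodule.mem_bot R).mp hr, zero_smul]
      refine extVanishes_quotient_of_add_coheight_lt (t := i) hlow ⟨p, hp⟩ 0 ?_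
      have h1 : (Order.coheight (⟨p, hp⟩ : PrimeSpectrum R) : WithBot ℕ∞) ≤ n :=
        (Order.coheight_le_krullDim _).trans hn.le
      have h2 : Order.coheight (⟨p, hp⟩ : PrimeSpectrum R) ≤ (n : ℕ∞) := by exact_mod_cast h1
      calc ((0 : ℕ) : ℕ∞) + _ ≤ (n : ℕ∞) := by simpa using h2
        _ < i := by exact_mod_cast hlt
    have := extVanishes_zero_iff.mp h0
    exact one_ne_zero (congrArg (fun f : R →ₗ[R] R => f 1)
      (Subsingleton.elim (LinearMap.id : R →ₗ[R] R) 0))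
  obtain rfl : i = n := le_antisymm hin hni
  constructor
  · rintro h rfl
    exact hi h
  · intro h
    rcases lt_or_gt_of_ne h with h | h
    · exact hlow j h
    · exact hhigh j h

end Gorenstein

section IsGorensteinLocalRing

variable [IsGorensteinLocalRing R] {n : ℕ}

theorem exists_forall_extVanishes :
    ∃ D : ℕ, ∀ (M : Type u) [AddCommGroup M] [Module R M], ∀ j > D, ExtVanishes R M R j := by
  obtain ⟨k, hk⟩ := IsGorensteinLocalRing.finite_injectiveDimension (R := R)
  exact ⟨k, fun M _ _ j hj => HasInjectiveDimensionLT.subsingleton _ (k + 1) j hj _⟩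

theorem extVanishes_residueField_iff_ne (hn : ringKrullDim R = n) (j : ℕ) :
    ExtVanishes R (R ⧸ maximalIdeal R) R j ↔ j ≠ n := by
  refine extVanishes_residueField_iff hn ?_ j
  obtain ⟨D, hD⟩ := exists_forall_extVanishes (R := R)
  exact ⟨D, fun j hj => hD _ j hj⟩

/-- The self-injective dimension of a Gorenstein local ring is at most its Krull dimension. -/
theorem extVanishes_of_dim_lt (hn : ringKrullDim R = n) (M : Type u) [AddCommGroup M]
    [Module R M] {j : ℕ} (hj : n < j) : ExtVanishes R M R j := by
  obtain ⟨j, rfl⟩ : ∃ j', j = j' + 1 := ⟨j - 1, by omega⟩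
  refine extVanishes_of_forall_ideal (fun a => ?_) M
  exact extVanishes_of_finite_of_lt
    (fun k hk => (extVanishes_residueField_iff_ne hn k).mpr (by omega)) _ _ hj

/-- A Gorenstein local ring is Cohen–Macaulay: the grade of an ideal is at least its height. -/
theorem extVanishes_of_lt_height (hn : ringKrullDim R = n) {I : Ideal R} {c : ℕ}
    (hc : I.height = c) {j : ℕ} (hj : j < c) (k : ℕ) (M : Type u) [AddCommGroup M] [Module R M]
    [Module.Finite R M] (hM : ∀ r ∈ I ^ k, ∀ m : M, r • m = 0) : ExtVanishes R M R j := by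
  refine extVanishes_of_forall_isPrime (I ^ k) (fun p hp hle => ?_) M hM
  have hIp : I ≤ p := hp.le_of_pow_le hle
  refine extVanishes_quotient_of_add_coheight_lt (t := n)
    (fun i hi => (extVanishes_residueField_iff_ne hn i).mpr hi.ne) ⟨p, hp⟩ j ?_
  have h1 : Order.height (⟨p, hp⟩ : PrimeSpectrum R) +
      Order.coheight (⟨p, hp⟩ : PrimeSpectrum R) ≤ (n : ℕ∞) := by
    have h := Order.krullDim_eq_iSup_height_add_coheight_of_nonempty (α := PrimeSpectrum R)
    have h2 : (⨆ a : PrimeSpectrum R, Order.height a + Order.coheight a) = (n : ℕ∞) := by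
      have h3 : Order.krullDim (PrimeSpectrum R) = n := hn
      rw [h3] at h
      exact_mod_cast h.symm
    exact h2 ▸ le_iSup (fun a : PrimeSpectrum R => Order.height a + Order.coheight a) _
  have h2 : (c : ℕ∞) ≤ Order.height (⟨p, hp⟩ : PrimeSpectrum R) := by
    rw [← hc, ← PrimeSpectrum.height_eq_orderHeight]
    exact Ideal.height_mono hIp
  generalize Order.coheight (⟨p, hp⟩ : PrimeSpectrum R) = b at h1 ⊢
  generalize Order.height (⟨p, hp⟩ : PrimeSpectrum R) = a at h1 h2
  have h3 : (c : ℕ∞) + b ≤ n := (add_le_add_left h2 b).trans h1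
  have hb : b ≠ ⊤ := by
    rintro rfl
    simp at h3
  lift b to ℕ using hb
  norm_cast at h3 ⊢
  omega

end IsGorensteinLocalRing

end LocCoh

/-! ### `Ext` into a complete local ring from modules with an invertible element -/

namespace LocCoh

variable {R : Type u} [CommRing R]

section AdicallyComplete

variable [IsLocalRing R] [IsAdicComplete (maximalIdeal R) R] {x : R}

theorem eq_zero_of_forall_eq_pow_mul (hx : x ∈ maximalIdeal R) {r : R}
    (h : ∀ k : ℕ, ∃ s, r = x ^ k * s) : r = 0 := by
  refine IsHausdorff.haus (I := maximalIdeal R) inferInstance r fun k => ?_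
  obtain ⟨s, rfl⟩ := h k
  rw [SModEq.zero, smul_eq_mul, Ideal.mul_top]
  exact Ideal.mul_mem_right _ _ (Ideal.pow_mem_pow hx k)

/-- The recursion `b k = a k + x * b (k + 1)` is solved by `b k = ∑ x ^ j * a (k + j)`. -/
theorem exists_forall_eq_add_mul_succ (hx : x ∈ maximalIdeal R) (a : ℕ → R) :
    ∃ b : ℕ → R, ∀ k, b k = a k + x * b (k + 1) := by
  have hlim (k : ℕ) : ∃ L : R, ∀ N : ℕ,
      (∑ j ∈ Finset.range N, x ^ j * a (k + j)) - L ∈ maximalIdeal R ^ N := by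
    obtain ⟨L, hL⟩ := IsPrecomplete.prec (I := maximalIdeal R) (M := R) inferInstance
      (f := fun N => ∑ j ∈ Finset.range N, x ^ j * a (k + j)) (by
        intro m n hmn
        rw [SModEq.sub_mem, smul_eq_mul, Ideal.mul_top, ← neg_sub, neg_mem_iff,
          ← Finset.sum_range_add_sum_Ico _ hmn, add_sub_cancel_left]
        refine Ideal.sum_mem _ fun j hj => Ideal.mul_mem_right _ _ ?_
        exact Ideal.pow_le_pow_right (Finset.mem_Ico.mp hj).1 (Ideal.pow_mem_pow hx j))
    refine ⟨L, fun N => ?_⟩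
    have := hL N
    rwa [SModEq.sub_mem, smul_eq_mul, Ideal.mul_top] at this
  choose b hb using hlim
  refine ⟨b, fun k => sub_eq_zero.mp ?_⟩
  refine IsHausdorff.haus (I := maximalIdeal R) inferInstance _ fun N => ?_
  rw [SModEq.zero, smul_eq_mul, Ideal.mul_top]
  have h1 := Ideal.pow_le_pow_right (Nat.le_succ N) (hb k (N + 1))
  have h2 := Ideal.mul_mem_left _ x (hb (k + 1) N)
  have h3 : ∑ j ∈ Finset.range (N + 1), x ^ j * a (k + j) =
      a k + x * ∑ j ∈ Finset.range N, x ^ j * a (k + 1 + j) := by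
    rw [Finset.sum_range_succ', Finset.mul_sum, add_comm]
    congr 1
    · simp
    · refine Finset.sum_congr rfl fun j _ => ?_
      rw [show k + (j + 1) = k + 1 + j by ring]
      ring
  have h4 : b k - (a k + x * b (k + 1)) =
      x * (∑ j ∈ Finset.range N, x ^ j * a (k + 1 + j) - b (k + 1)) -
      (∑ j ∈ Finset.range (N + 1), x ^ j * a (k + j) - b k) := by
    rw [h3]; ring
  rw [h4]
  exact sub_mem h2 h1

variable {M : Type u} [AddCommGroup M] [Module R M]

theorem extVanishes_zero_of_bijective_smul (hx : x ∈ maximalIdeal R)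
    (hM : Function.Bijective fun m : M => x • m) : ExtVanishes R M R 0 := by
  rw [extVanishes_zero_iff]
  refine subsingleton_of_forall_eq 0 fun f => LinearMap.ext fun m => ?_
  refine eq_zero_of_forall_eq_pow_mul hx fun k => ?_
  suffices ∃ m', m = x ^ k • m' by
    obtain ⟨m', rfl⟩ := this
    exact ⟨f m', by rw [map_smul, smul_eq_mul]⟩
  induction k with
  | zero => exact ⟨m, by simp⟩
  | succ k ih =>
    obtain ⟨m', rfl⟩ := ih
    obtain ⟨m'', rfl⟩ := hM.2 m'
    exact ⟨m'', by rw [pow_succ, mul_smul]⟩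

/-- A homomorphism `θ` from a module on which `x` is invertible to a quotient `Q/R` lifts to `Q`:
the lift of `θ(v)` is the unique preimage which is the start of a sequence of successive
divisions by `x` lifting `θ(v), θ(x⁻¹v), θ(x⁻²v), …`. -/
theorem exists_lift_of_bijective_smul (hx : x ∈ maximalIdeal R)
    (hM : Function.Bijective fun m : M => x • m) {Q Q' : Type u} [AddCommGroup Q] [Module R Q]
    [AddCommGroup Q'] [Module R Q'] (f : R →ₗ[R] Q) (g : Q →ₗ[R] Q') (hf : Function.Injective f)
    (hg : Function.Surjective g) (hfg : Function.Exact f g) (θ : M →ₗ[R] Q') :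
    ∃ ψ : M →ₗ[R] Q, g ∘ₗ ψ = θ := by
  let P : M → Q → Prop := fun v q => ∃ (vs : ℕ → M) (qs : ℕ → Q), vs 0 = v ∧ qs 0 = q ∧
    (∀ k, x • vs (k + 1) = vs k) ∧ (∀ k, x • qs (k + 1) = qs k) ∧ ∀ k, g (qs k) = θ (vs k)
  have hadd {v v' : M} {q q' : Q} (h : P v q) (h' : P v' q') (r : R) :
      P (r • v + v') (r • q + q') := by
    obtain ⟨vs, qs, rfl, rfl, h1, h2, h3⟩ := h
    obtain ⟨vs', qs', rfl, rfl, h1', h2', h3'⟩ := h'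
    refine ⟨fun k => r • vs k + vs' k, fun k => r • qs k + qs' k, rfl, rfl, fun k => ?_,
      fun k => ?_, fun k => ?_⟩
    · rw [smul_add, smul_comm, h1, h1']
    · rw [smul_add, smul_comm, h2, h2']
    · rw [map_add, map_add, map_smul, map_smul, h3, h3']
  have hzero {q : Q} (h : P 0 q) : q = 0 := by
    obtain ⟨vs, qs, hv, rfl, h1, h2, h3⟩ := h
    have hvs (k : ℕ) : vs k = 0 := by
      induction k with
      | zero => exact hv
      | succ k ih => exact hM.1 (by simp only [h1, ih, smul_zero])
    have hqs (k : ℕ) : qs 0 = x ^ k • qs k := by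
      induction k with
      | zero => simp
      | succ k ih => rw [ih, pow_succ, mul_smul, h2]
    have hr (k : ℕ) : ∃ r, f r = qs k := (hfg _).mp (by rw [h3, hvs, map_zero])
    choose r hr using hr
    rw [← hr 0, eq_zero_of_forall_eq_pow_mul hx (r := r 0) fun k => ⟨r k, hf ?_⟩, map_zero]
    rw [← smul_eq_mul, map_smul, hr, hr, hqs k]
  have hex (v : M) : ∃ q, P v q := by
    choose e he using hM.2
    let vs : ℕ → M := fun k => Nat.rec v (fun _ w => e w) k
    have hvs (k : ℕ) : x • vs (k + 1) = vs k := he (vs k)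
    choose qs hqs using fun k => hg (θ (vs k))
    have ha (k : ℕ) : ∃ a, f a = x • qs (k + 1) - qs k := (hfg _).mp (by
      rw [map_sub, map_smul, hqs, hqs, ← map_smul, hvs, sub_self])
    choose a ha using ha
    obtain ⟨b, hb⟩ := exists_forall_eq_add_mul_succ hx a
    refine ⟨qs 0 + f (b 0), vs, fun k => qs k + f (b k), rfl, rfl, hvs, fun k => ?_, fun k => ?_⟩
    · have h1 := congrArg f (hb k)
      rw [map_add, ← smul_eq_mul, map_smul, ha] at h1
      change x • (qs (k + 1) + f (b (k + 1))) = qs k + f (b k)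
      rw [h1, smul_add]
      abel
    · rw [map_add, hqs, hfg.apply_apply_eq_zero, add_zero]
  choose ψ hψ using hex
  have huniq {v : M} {q q' : Q} (h : P v q) (h' : P v q') : q = q' := by
    have := hzero (by simpa using hadd h h' (-1))
    rw [neg_add_eq_zero] at this
    exact this
  have h0 : P 0 0 := ⟨fun _ => 0, fun _ => 0, rfl, rfl, by simp, by simp, by simp⟩
  refine ⟨⟨⟨ψ, fun v v' => ?_⟩, fun r v => ?_⟩, LinearMap.ext fun v => ?_⟩
  · exact huniq (hψ _) (by simpa using hadd (hψ v) (hψ v') 1)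
  · exact huniq (hψ _) (by simpa using hadd (hψ v) h0 r)
  · obtain ⟨vs, qs, hv, hq, -, -, h3⟩ := hψ v
    have := h3 0
    rwa [hv, hq] at this

theorem extVanishes_one_of_bijective_smul (hx : x ∈ maximalIdeal R)
    (hM : Function.Bijective fun m : M => x • m) : ExtVanishes R M R 1 := by
  obtain ⟨Q, f, hQ, hf⟩ := exists_embedding_in_injective R R
  have hg := (LinearMap.range f).mkQ_surjective
  have hfg : Function.Exact f (LinearMap.range f).mkQ := LinearMap.exact_map_mkQ_range f
  have hS := shortComplexOfExact_shortExact hf hg hfg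
  rw [extVanishes_iff_forall_eq_zero]
  intro y
  obtain ⟨z, rfl⟩ := Ext.covariant_sequence_exact₁ (ModuleCat.of R M) hS y
    (extVanishes_iff_forall_eq_zero.mp (extVanishes_of_injective (N := Q) 0) _) (zero_add 1)
  obtain ⟨θ, rfl⟩ := (Ext.mk₀_bijective _ _).surjective z
  obtain ⟨ψ, hψ⟩ := exists_lift_of_bijective_smul hx hM f _ hf hg hfg θ.hom
  let ψ' : ModuleCat.of R M ⟶ (shortComplexOfExact f _ hfg).X₂ := ModuleCat.ofHom ψ
  have hθ : θ = ψ' ≫ (shortComplexOfExact f _ hfg).g := by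
    ext m
    exact (LinearMap.congr_fun hψ m).symm
  rw [hθ, ← Ext.mk₀_comp_mk₀, Ext.comp_assoc_of_second_deg_zero, hS.comp_extClass, Ext.comp_zero]
  rfl

end AdicallyComplete

section Telescope

variable (x : R) (P : Type u) [AddCommGroup P] [Module R P]

/-- The map `u ↦ u - x σ(u)` on `P^(ℕ)`, `σ` being the shift. Its cokernel is the localisation
of `P` at `x`. -/
noncomputable def telescope : (ℕ →₀ P) →ₗ[R] (ℕ →₀ P) :=
  LinearMap.id - x • Finsupp.lmapDomain P R Nat.succ

variable {P}

theorem lmapDomain_succ_zero (u : ℕ →₀ P) : Finsupp.lmapDomain P R Nat.succ u 0 = 0 :=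
  Finsupp.mapDomain_of_notMem_range _ _ (by simp)

theorem lmapDomain_succ_succ (u : ℕ →₀ P) (k : ℕ) :
    Finsupp.lmapDomain P R Nat.succ u (k + 1) = u k :=
  Finsupp.mapDomain_apply Nat.succ_injective _ _

theorem telescope_apply (u : ℕ →₀ P) :
    telescope x P u = u - x • Finsupp.lmapDomain P R Nat.succ u := rfl

theorem telescope_injective : Function.Injective (telescope x P) := by
  rw [injective_iff_map_eq_zero]
  intro u hu
  rw [telescope_apply, sub_eq_zero] at hu
  ext k
  induction k with
  | zero => rw [hu, Finsupp.smul_apply, lmapDomain_succ_zero, smul_zero]; rfl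
  | succ k ih => rw [hu, Finsupp.smul_apply, lmapDomain_succ_succ, ih]; simp

theorem bijective_smul_telescope_quotient :
    Function.Bijective fun m : (ℕ →₀ P) ⧸ LinearMap.range (telescope x P) => x • m := by
  constructor
  · change Function.Injective (LinearMap.lsmul R _ x)
    rw [injective_iff_map_eq_zero]
    intro y hy
    obtain ⟨s, rfl⟩ := Submodule.Quotient.mk_surjective _ y
    rw [LinearMap.lsmul_apply, ← Submodule.Quotient.mk_smul, Submodule.Quotient.mk_eq_zero] at hy
    obtain ⟨u, hu⟩ := hy
    rw [telescope_apply, sub_eq_iff_eq_add, ← smul_add] at hu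
    refine (Submodule.Quotient.mk_eq_zero _).mpr
      ⟨s + Finsupp.lmapDomain P R Nat.succ u, ?_⟩
    rw [telescope_apply, ← map_smul, ← hu, add_sub_cancel_right]
  · intro y
    obtain ⟨s, rfl⟩ := Submodule.Quotient.mk_surjective _ y
    refine ⟨Submodule.Quotient.mk (Finsupp.lmapDomain P R Nat.succ s), ?_⟩
    change x • Submodule.Quotient.mk _ = _
    rw [← Submodule.Quotient.mk_smul, eq_comm, Submodule.Quotient.eq]
    exact ⟨s, telescope_apply x s⟩

theorem extVanishes_telescope_quotient [Module.Projective R (ℕ →₀ P)] {N : Type u}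
    [AddCommGroup N] [Module R N] (j : ℕ) :
    ExtVanishes R ((ℕ →₀ P) ⧸ LinearMap.range (telescope x P)) N (j + 2) :=
  ExtVanishes.source_right (telescope_injective x) (Submodule.mkQ_surjective _)
    (LinearMap.exact_map_mkQ_range _) (extVanishes_of_projective j)
    (extVanishes_of_projective (j + 1))

variable {x} in
/-- A map from `P` to a module on which `x` is invertible extends to the localisation of `P`. -/
theorem exists_surjective_from_telescope_quotient {M : Type u} [AddCommGroup M] [Module R M]
    (hM : Function.Bijective fun m : M => x • m) (φ : P →ₗ[R] M) (hφ : Function.Surjective φ) :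
    ∃ g : ((ℕ →₀ P) ⧸ LinearMap.range (telescope x P)) →ₗ[R] M, Function.Surjective g := by
  let e : M ≃ₗ[R] M := LinearEquiv.ofBijective (LinearMap.lsmul R M x) hM
  have he (m : M) : x • e.symm m = m := e.apply_symm_apply m
  let G : (ℕ →₀ P) →ₗ[R] M :=
    Finsupp.lsum R fun k => ((e.symm.toLinearMap ^ k : M →ₗ[R] M) ∘ₗ φ)
  have hG : LinearMap.range (telescope x P) ≤ LinearMap.ker G := by
    rw [LinearMap.range_le_ker_iff]
    refine Finsupp.lhom_ext fun k p => ?_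
    have : G (Finsupp.lmapDomain P R Nat.succ (Finsupp.single k p)) =
        e.symm (G (Finsupp.single k p)) := by
      rw [Finsupp.lmapDomain_apply, Finsupp.mapDomain_single]
      simp [G, pow_succ']
    rw [LinearMap.comp_apply, telescope_apply, map_sub, map_smul, this, he, sub_self]
    rfl
  refine ⟨Submodule.liftQ _ G hG, fun m => ?_⟩
  obtain ⟨p, rfl⟩ := hφ m
  exact ⟨Submodule.Quotient.mk (Finsupp.single 0 p), by
    rw [Submodule.liftQ_apply]; simp [G]⟩

end Telescope

/-- Over an adically complete local ring `R`, a module on which some `x ∈ 𝔪` acts invertibly has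
no `Ext` into `R`. -/
theorem extVanishes_of_bijective_smul [IsLocalRing R] [IsAdicComplete (maximalIdeal R) R] {x : R}
    (hx : x ∈ maximalIdeal R) (j : ℕ) : ∀ (M : Type u) [AddCommGroup M] [Module R M],
    (Function.Bijective fun m : M => x • m) → ExtVanishes R M R j := by
  induction j using Nat.twoStepInduction with
  | zero => exact fun M _ _ hM => extVanishes_zero_of_bijective_smul hx hM
  | one => exact fun M _ _ hM => extVanishes_one_of_bijective_smul hx hM
  | more j _ ih =>
    intro M _ _ hM
    obtain ⟨g, hg⟩ := exists_surjective_from_telescope_quotient hM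
      (Finsupp.linearCombination R (id : M → M)) (Finsupp.linearCombination_id_surjective R M)
    have hF := bijective_smul_telescope_quotient x (P := M →₀ R)
    refine ExtVanishes.source_right (LinearMap.ker g).injective_subtype hg
      (LinearMap.exact_subtype_ker_map g) (ih _ ⟨fun y z hyz => ?_, fun y => ?_⟩)
      (extVanishes_telescope_quotient x j)
    · exact Subtype.ext (hF.1 (congrArg Subtype.val hyz))
    · obtain ⟨z, hz⟩ := hF.2 y.1
      refine ⟨⟨z, hM.1 ?_⟩, Subtype.ext hz⟩
      change x • g z = x • 0
      rw [← map_smul, show x • z = y.1 from hz, smul_zero]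
      exact y.2

end LocCoh

/-! ### Torsion submodules -/

namespace LocCoh

variable {R : Type u} [CommRing R]

section GammaSubmodule

variable {M : Type u} [AddCommGroup M] [Module R M]

theorem gammaSubmodule_anti {a b : Ideal R} (h : a ≤ b) :
    gammaSubmodule b M ≤ gammaSubmodule a M := fun _ ⟨k, hk⟩ =>
  ⟨k, fun r hr => hk r (Ideal.pow_right_mono h k hr)⟩

theorem gammaSubmodule_bot : gammaSubmodule (⊥ : Ideal R) M = ⊤ :=
  top_unique fun m _ => ⟨1, fun r hr => by
    rw [pow_one] at hr
    rw [(Submodule.mem_bot R).mp hr, zero_smul]⟩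

theorem gammaSubmodule_sup (a b : Ideal R) :
    gammaSubmodule (a ⊔ b) M = gammaSubmodule a M ⊓ gammaSubmodule b M := by
  refine le_antisymm (le_inf (gammaSubmodule_anti le_sup_left) (gammaSubmodule_anti le_sup_right))
    fun m ⟨⟨k, hk⟩, l, hl⟩ => ⟨k + l, fun r hr => ?_⟩
  obtain ⟨s, hs, t, ht, rfl⟩ := Submodule.mem_sup.mp (Ideal.sup_pow_add_le_pow_sup_pow hr)
  rw [add_smul, hk s hs, hl t ht, add_zero]

theorem mem_gammaSubmodule_span_singleton {x : R} {m : M} :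
    m ∈ gammaSubmodule (Ideal.span {x}) M ↔ ∃ k : ℕ, x ^ k • m = 0 := by
  refine exists_congr fun k => ⟨fun h => h _ ?_, fun h r hr => ?_⟩
  · exact Ideal.pow_mem_pow (Ideal.mem_span_singleton_self x) k
  · rw [Ideal.span_singleton_pow] at hr
    obtain ⟨s, rfl⟩ := Ideal.mem_span_singleton'.mp hr
    rw [mul_smul, h, smul_zero]

theorem exists_pow_smul_eq_zero_of_fg {a : Ideal R} {N : Submodule R M} (hN : N.FG)
    (h : N ≤ gammaSubmodule a M) : ∃ k : ℕ, ∀ r ∈ a ^ k, ∀ m ∈ N, r • m = 0 := by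
  induction N, hN using Submodule.fg_induction with
  | singleton m =>
    obtain ⟨k, hk⟩ := h (Submodule.mem_span_singleton_self m)
    refine ⟨k, fun r hr m' hm' => ?_⟩
    obtain ⟨s, rfl⟩ := Submodule.mem_span_singleton.mp hm'
    rw [smul_comm, hk r hr, smul_zero]
  | sup N₁ N₂ _ _ h₁ h₂ =>
    obtain ⟨k, hk⟩ := h₁ (le_sup_left.trans h)
    obtain ⟨l, hl⟩ := h₂ (le_sup_right.trans h)
    refine ⟨k + l, fun r hr m hm => ?_⟩
    obtain ⟨m₁, hm₁, m₂, hm₂, rfl⟩ := Submodule.mem_sup.mp hm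
    rw [smul_add, hk r (Ideal.pow_le_pow_right (Nat.le_add_right k l) hr) _ hm₁,
      hl r (Ideal.pow_le_pow_right (Nat.le_add_left l k) hr) _ hm₂, add_zero]

theorem mem_gammaSubmodule_of_smul_mem {a : Ideal R} {x : R} {m : M}
    (hm : m ∈ gammaSubmodule a M) (hxm : x • m ∈ gammaSubmodule (a ⊔ Ideal.span {x}) M) :
    m ∈ gammaSubmodule (a ⊔ Ideal.span {x}) M := by
  rw [gammaSubmodule_sup] at *
  obtain ⟨k, hk⟩ := mem_gammaSubmodule_span_singleton.mp hxm.2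
  exact ⟨hm, mem_gammaSubmodule_span_singleton.mpr ⟨k + 1, by rwa [pow_succ, mul_smul]⟩⟩

variable [IsNoetherianRing R]

/-- `M/Γ_a(M)` has no `a`-torsion. -/
theorem mem_gammaSubmodule_of_forall_smul_mem {a : Ideal R} {m : M} {k : ℕ}
    (h : ∀ r ∈ a ^ k, r • m ∈ gammaSubmodule a M) : m ∈ gammaSubmodule a M := by
  obtain ⟨l, hl⟩ := exists_pow_smul_eq_zero_of_fg (a := a)
    (N := Submodule.map (LinearMap.toSpanSingleton R M m) (a ^ k))
    (Submodule.FG.map _ (IsNoetherian.noetherian (a ^ k))) (by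
      rintro _ ⟨r, hr, rfl⟩
      exact h r hr)
  refine ⟨l + k, fun r hr => ?_⟩
  rw [pow_add] at hr
  induction hr using Submodule.mul_induction_on' with
  | mem_mul_mem s hs t ht => rw [mul_smul]; exact hl s hs _ ⟨t, ht, rfl⟩
  | add s _ t _ hs ht => rw [add_smul, hs, ht, add_zero]

/-- The Artin–Rees lemma implies that `Γ_a` preserves injective modules. -/
theorem injective_gammaSubmodule (a : Ideal R) [Module.Injective R M] :
    Module.Injective R (gammaSubmodule a M) := by
  refine Module.Baer.injective fun b f => ?_
  obtain ⟨k, hk⟩ := exists_pow_smul_eq_zero_of_fg (a := a)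
    (N := LinearMap.range ((gammaSubmodule a M).subtype ∘ₗ f))
    (by
      rw [LinearMap.range_eq_map]
      exact (Module.finite_def.mp inferInstance).map _) (by
      rintro _ ⟨r, rfl⟩
      exact (f r).2)
  obtain ⟨k₀, hk₀⟩ := Ideal.exists_pow_inf_eq_pow_smul a (M := R) b
  have hAR (r : R) (hr : r ∈ a ^ (k₀ + k)) (hrb : r ∈ b) : f ⟨r, hrb⟩ = 0 := by
    have h1 : r ∈ a ^ k • b := by
      have h2 : r ∈ a ^ (k₀ + k) • (⊤ : Submodule R R) ⊓ b :=
        ⟨by rwa [smul_eq_mul, Ideal.mul_top], hrb⟩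
      rw [hk₀ _ (Nat.le_add_right _ _), Nat.add_sub_cancel_left] at h2
      exact Submodule.smul_mono le_rfl inf_le_right h2
    suffices ∀ s ∈ a ^ k • b, ∀ hs : s ∈ b, f ⟨s, hs⟩ = 0 from this r h1 hrb
    intro s hs
    induction hs using Submodule.smul_induction_on' with
    | smul t ht u hu =>
      intro htu
      have : (⟨t • u, htu⟩ : b) = t • ⟨u, hu⟩ := rfl
      rw [this, map_smul]
      exact Subtype.ext (hk t ht _ ⟨⟨u, hu⟩, rfl⟩)
    | add t ht u hu h1 h2 =>
      intro htu
      have htb : t ∈ b := Submodule.smul_le_right ht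
      have hub : u ∈ b := Submodule.smul_le_right hu
      have : (⟨t + u, htu⟩ : b) = ⟨t, htb⟩ + ⟨u, hub⟩ := rfl
      rw [this, map_add, h1, h2, add_zero]
  let φ : b →ₗ[R] R ⧸ a ^ (k₀ + k) := (a ^ (k₀ + k)).mkQ ∘ₗ b.subtype
  have hφ : LinearMap.ker φ ≤ LinearMap.ker ((gammaSubmodule a M).subtype ∘ₗ f) := by
    intro r hr
    have h1 : (r : R) ∈ a ^ (k₀ + k) := (Submodule.Quotient.mk_eq_zero _).mp hr
    have h2 := hAR r h1 r.2
    exact congrArg Subtype.val h2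
  obtain ⟨h, hh⟩ := Module.Injective.out (Submodule.liftQ _ φ le_rfl)
    (LinearMap.ker_eq_bot.mp (Submodule.ker_liftQ_eq_bot _ _ _ le_rfl))
    (Submodule.liftQ _ ((gammaSubmodule a M).subtype ∘ₗ f) hφ)
  refine ⟨(h ∘ₗ (a ^ (k₀ + k)).mkQ).codRestrict _ fun r => ⟨k₀ + k, fun s hs => ?_⟩,
    fun r hr => Subtype.ext ?_⟩
  · rw [← map_smul]
    change h (Submodule.Quotient.mk (s • r)) = 0
    have : (Submodule.Quotient.mk (s • r) : R ⧸ a ^ (k₀ + k)) = 0 :=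
      (Submodule.Quotient.mk_eq_zero _).mpr (Ideal.mul_mem_right r _ hs)
    rw [this, map_zero]
  · exact hh (Submodule.Quotient.mk ⟨r, hr⟩)

/-- For injective `M`, multiplication by `x` is surjective on `Γ_a(M)/Γ_{(a, x)}(M)`. -/
theorem exists_sub_smul_mem_gammaSubmodule [Module.Injective R M] (a : Ideal R) (x : R) {m : M}
    (hm : m ∈ gammaSubmodule a M) :
    ∃ m' ∈ gammaSubmodule a M, m - x • m' ∈ gammaSubmodule (a ⊔ Ideal.span {x}) M := by
  have hinj : Module.Injective R (gammaSubmodule a M) := injective_gammaSubmodule a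
  -- `k` is chosen so that `x ^ k` and `x ^ (k + 1)` have the same annihilator
  obtain ⟨k, hk⟩ := monotone_stabilizes_iff_noetherian.mpr (inferInstance : IsNoetherian R R)
    ⟨fun k => LinearMap.ker (LinearMap.lsmul R R (x ^ k)), monotone_nat_of_le_succ fun k r hr => by
      simp only [LinearMap.mem_ker, LinearMap.lsmul_apply, smul_eq_mul] at hr ⊢
      rw [pow_succ', mul_assoc, hr, mul_zero]⟩
  let φ : R →ₗ[R] R := LinearMap.lsmul R R (x ^ (k + 1))
  let ψ : R →ₗ[R] gammaSubmodule a M :=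
    LinearMap.toSpanSingleton R _ (x ^ k • (⟨m, hm⟩ : gammaSubmodule a M))
  have hφ : LinearMap.ker φ ≤ LinearMap.ker ψ := by
    have := hk (k + 1) (Nat.le_succ k)
    change LinearMap.ker (LinearMap.lsmul R R (x ^ k)) = LinearMap.ker φ at this
    rw [← this]
    intro r hr
    have h1 : x ^ k * r = 0 := hr
    change r • x ^ k • (⟨m, hm⟩ : gammaSubmodule a M) = 0
    rw [smul_smul, mul_comm, h1, zero_smul]
  obtain ⟨h, hh⟩ := Module.Injective.out (Submodule.liftQ _ φ le_rfl)
    (LinearMap.ker_eq_bot.mp (Submodule.ker_liftQ_eq_bot _ _ _ le_rfl))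
    (Submodule.liftQ _ ψ hφ)
  have h1 : x ^ (k + 1) • h 1 = x ^ k • (⟨m, hm⟩ : gammaSubmodule a M) := by
    have h2 : h (x ^ (k + 1) • 1) = (1 : R) • x ^ k • (⟨m, hm⟩ : gammaSubmodule a M) :=
      hh (Submodule.Quotient.mk 1)
    rwa [map_smul, one_smul] at h2
  refine ⟨h 1, (h 1).2, ?_⟩
  rw [gammaSubmodule_sup]
  refine ⟨sub_mem hm (Submodule.smul_mem _ _ (h 1).2), mem_gammaSubmodule_span_singleton.mpr
    ⟨k, ?_⟩⟩
  have h3 : x ^ (k + 1) • (h 1 : M) = x ^ k • m := congrArg Subtype.val h1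
  rw [smul_sub, smul_smul, ← pow_succ, h3, sub_self]

end GammaSubmodule

end LocCoh

/-! ### Local cohomology modules -/

namespace LocCoh

variable {R : Type u} [CommRing R]

/-- Local cohomology as cocycles modulo coboundaries of the `a`-torsion of an injective
resolution. -/
theorem exists_surjective_cocycles {M : ModuleCat.{u} R} (E : InjectiveResolution M) (a : Ideal R)
    {i j k : ℕ} (hi : (ComplexShape.up ℕ).prev j = i) (hk : (ComplexShape.up ℕ).next j = k) :
    ∃ q : ↥(gammaSubmodule a (E.cocomplex.X j) ⊓ LinearMap.ker (E.cocomplex.d j k).hom) →ₗ[R]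
        (localCohomologyFunctor a j).obj M,
      Function.Surjective q ∧ ∀ y, q y = 0 ↔
        ∃ z ∈ gammaSubmodule a (E.cocomplex.X i), (E.cocomplex.d i j).hom z = y.1 := by
  let K := ((gamma a).mapHomologicalComplex (.up ℕ)).obj E.cocomplex
  let S := K.sc' i j k
  let Z := gammaSubmodule a (E.cocomplex.X j) ⊓ LinearMap.ker (E.cocomplex.d j k).hom
  let e : S.moduleCatLeftHomologyData.H ≅ (localCohomologyFunctor a j).obj M :=
    S.moduleCatHomologyIso.symm ≪≫ (ShortComplex.homologyMapIso (K.isoSc' i j k hi hk)).symm ≪≫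
      (E.isoRightDerivedObj (gamma a) j).symm
  let p : S.moduleCatLeftHomologyData.K ⟶ S.moduleCatLeftHomologyData.H :=
    S.moduleCatLeftHomologyData.π
  have hp (y : LinearMap.ker S.g.hom) : p.hom y = 0 ↔ ∃ z, S.f.hom z = y.1 := by
    refine (Submodule.Quotient.mk_eq_zero (LinearMap.range S.moduleCatToCycles)).trans ⟨?_, ?_⟩
    · rintro ⟨z, hz⟩
      exact ⟨z, congrArg Subtype.val hz⟩
    · rintro ⟨z, hz⟩
      exact ⟨z, Subtype.ext hz⟩
  let t : Z →ₗ[R] LinearMap.ker S.g.hom := LinearMap.codRestrict _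
    (Submodule.inclusion inf_le_left) fun y => Subtype.ext y.2.2
  have he : Function.Bijective e.hom.hom := ConcreteCategory.bijective_of_isIso e.hom
  refine ⟨e.hom.hom ∘ₗ p.hom ∘ₗ t, fun w => ?_, fun y => ?_⟩
  · obtain ⟨w, rfl⟩ := he.2 w
    obtain ⟨⟨y, hy⟩, rfl⟩ := (Submodule.mkQ_surjective _ : Function.Surjective p.hom) w
    exact ⟨⟨y.1, y.2, congrArg Subtype.val hy⟩, rfl⟩
  · refine (map_eq_zero_iff e.hom.hom he.1).trans ((hp _).trans ?_)
    exact ⟨fun ⟨z, hz⟩ => ⟨z.1, z.2, congrArg Subtype.val hz⟩,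
      fun ⟨z, hz, h⟩ => ⟨⟨z, hz⟩, Subtype.ext h⟩⟩

/-- If `y` is killed by `b`, then it is the image of `1` under a linear map from `R ⧸ b`. -/
theorem exists_quotient_hom {b : Ideal R} {M : Type u} [AddCommGroup M] [Module R M] {y : M}
    (hy : ∀ r ∈ b, r • y = 0) : ∃ f : R ⧸ b →ₗ[R] M, f (Ideal.Quotient.mk b 1) = y :=
  ⟨Submodule.liftQ b (LinearMap.toSpanSingleton R M y) hy, by
    change (1 : R) • y = y
    rw [one_smul]⟩

/-- Since `H^j_a(M)` is the colimit of the modules `Ext^j(R ⧸ a ^ k, M)`, it vanishes if they do. -/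
theorem subsingleton_localCohomology (a : Ideal R) (M : Type u) [AddCommGroup M] [Module R M]
    (j : ℕ) (h : ∀ k, ExtVanishes R (R ⧸ a ^ k) M j) :
    Subsingleton ((localCohomologyFunctor a j).obj (ModuleCat.of R M)) := by
  let E : InjectiveResolution (ModuleCat.of R M) := InjectiveResolution.of _
  obtain ⟨q, hq, hq'⟩ := exists_surjective_cocycles E a (j := j) rfl rfl
  suffices ∀ y, q y = 0 from ⟨fun u v => by
    obtain ⟨y, rfl⟩ := hq u
    obtain ⟨z, rfl⟩ := hq v
    rw [this, this]⟩
  rintro ⟨y, ⟨k, hy⟩, hdy⟩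
  have hdy' : (E.cocomplex.d j ((ComplexShape.up ℕ).next j)).hom y = 0 := hdy
  rw [CochainComplex.next] at hdy'
  obtain ⟨f, hf⟩ := exists_quotient_hom hy
  have hfd : ModuleCat.ofHom f ≫ E.cocomplex.d j (j + 1) = 0 := by
    refine ModuleCat.hom_ext (LinearMap.ext fun r => ?_)
    obtain ⟨r, rfl⟩ := Ideal.Quotient.mk_surjective r
    have : Ideal.Quotient.mk (a ^ k) r = r • Ideal.Quotient.mk (a ^ k) 1 := by
      rw [Algebra.smul_def, map_one, mul_one]
      rfl
    change (E.cocomplex.d j (j + 1)).hom (f _) = 0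
    rw [this, map_smul, hf, map_smul, hdy', smul_zero]
  rw [hq']
  obtain _ | j := j
  · obtain ⟨m, hm⟩ := (ShortComplex.moduleCat_exact_iff _).mp E.exact₀ y hdy'
    have hinj : Function.Injective (E.ι.f 0) := (ModuleCat.mono_iff_injective _).mp inferInstance
    let ι₀ : ((CochainComplex.single₀ _).obj (ModuleCat.of R M)).X 0 →ₗ[R] E.cocomplex.X 0 :=
      (E.ι.f 0).hom
    have hm' : ∀ r ∈ a ^ k, r • m = 0 := fun r hr => hinj (by
      change ι₀ (r • m) = ι₀ 0
      rw [map_smul, map_zero]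
      change r • (E.ι.f 0) m = 0
      rw [hm]; exact hy r hr)
    let m' : M := m
    have hm'' : ∀ r ∈ a ^ k, r • m' = 0 := hm'
    obtain ⟨g, hg⟩ := exists_quotient_hom hm''
    have h0 : m' = 0 := by
      rw [← hg, (extVanishes_zero_iff.mp (h k)).elim g 0, LinearMap.zero_apply]
    have hy0 : y = 0 := by
      rw [← hm]
      exact (congrArg ι₀ h0).trans (map_zero ι₀)
    exact ⟨0, zero_mem _, by rw [map_zero]; exact hy0.symm⟩
  · obtain ⟨g, hg⟩ := (E.extMk_eq_zero_iff (ModuleCat.ofHom f) _ rfl hfd j rfl).mp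
      ((h k).elim _ _)
    have hpj : (ComplexShape.up ℕ).prev (j + 1) = j := CochainComplex.prev_nat_succ j
    rw [hpj]
    refine ⟨g.hom (Ideal.Quotient.mk _ 1), ⟨k, fun r hr => ?_⟩, ?_⟩
    · rw [← map_smul]
      have : r • (Ideal.Quotient.mk (a ^ k)) 1 = 0 := by
        rw [Algebra.smul_def, map_one, mul_one]
        exact Ideal.Quotient.eq_zero_iff_mem.mpr hr
      rw [this, map_zero]
    · exact (congrArg (fun φ => φ.hom (Ideal.Quotient.mk (a ^ k) 1)) hg).trans hf

/-- An element supported only at the maximal ideal is `𝔪`-torsion. -/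
theorem mem_gammaSubmodule_maximalIdeal_of_forall_isPrime [IsNoetherianRing R]
    [IsLocalRing R] {M : Type u} [AddCommGroup M] [Module R M] {m : M}
    (h : ∀ (p : Ideal R) [p.IsPrime], p ≠ maximalIdeal R → ∃ s ∉ p, s • m = 0) :
    m ∈ gammaSubmodule (maximalIdeal R) M := by
  have h1 : maximalIdeal R ≤
      Ideal.radical (LinearMap.ker (LinearMap.toSpanSingleton R M m)) := by
    rw [Ideal.radical_eq_sInf]
    refine le_sInf fun p ⟨hp, hpp⟩ => ?_
    by_contra hne
    obtain ⟨s, hs, hsm⟩ := h p (fun h => hne h.ge)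
    exact hs (hp hsm)
  obtain ⟨k, hk⟩ := Ideal.exists_pow_le_of_le_radical_of_fg h1 (IsNoetherian.noetherian _)
  exact ⟨k, fun r hr => hk hr⟩

/-- An additive functor preserving injective objects and homology carries injective resolutions
to injective resolutions. -/
noncomputable def mapInjectiveResolution {C D : Type*} [Category* C] [Category* D] [Abelian C]
    [Abelian D] (F : C ⥤ D) [F.Additive] [F.PreservesInjectiveObjects] [F.PreservesHomology]
    {Z : C} (E : InjectiveResolution Z) : InjectiveResolution (F.obj Z) where
  cocomplex := (F.mapHomologicalComplex _).obj E.cocomplex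
  injective n := F.injective_obj_of_injective (E.injective n)
  ι := (HomologicalComplex.singleMapHomologicalComplex _ _ _).inv.app _ ≫
    (F.mapHomologicalComplex _).map E.ι
  quasiIso := inferInstance

theorem exists_mem_smul_eq_zero_of_fg {S : Submonoid R} {M : Type u}
    [AddCommGroup M] [Module R M]
    {N : Submodule R M} (hN : N.FG) (h : ∀ x ∈ N, ∃ t ∈ S, t • x = 0) :
    ∃ t ∈ S, ∀ x ∈ N, t • x = 0 := by
  induction N, hN using Submodule.fg_induction with
  | singleton m =>
    obtain ⟨t, ht, htm⟩ := h m (Submodule.mem_span_singleton_self m)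
    refine ⟨t, ht, fun x hx => ?_⟩
    obtain ⟨s, rfl⟩ := Submodule.mem_span_singleton.mp hx
    rw [smul_comm, htm, smul_zero]
  | sup N₁ N₂ _ _ h₁ h₂ =>
    obtain ⟨t₁, ht₁, h₁⟩ := h₁ fun x hx => h x (Submodule.mem_sup_left hx)
    obtain ⟨t₂, ht₂, h₂⟩ := h₂ fun x hx => h x (Submodule.mem_sup_right hx)
    refine ⟨t₁ * t₂, S.mul_mem ht₁ ht₂, fun x hx => ?_⟩
    obtain ⟨x₁, hx₁, x₂, hx₂, rfl⟩ := Submodule.mem_sup.mp hx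
    rw [smul_add, mul_comm, mul_smul, h₁ x₁ hx₁, mul_comm, mul_smul, h₂ x₂ hx₂, smul_zero,
      smul_zero, add_zero]

section LocalizedModule

variable {S : Submonoid R} {A : Type u} [CommRing A] [Algebra R A] {a : Ideal R}
  {M₀ M₁ N₀ N₁ : Type u} [AddCommGroup M₀] [Module R M₀] [AddCommGroup M₁] [Module R M₁]
  [AddCommGroup N₀] [Module R N₀] [Module A N₀] [IsScalarTower R A N₀]
  [AddCommGroup N₁] [Module R N₁] [Module A N₁] [IsScalarTower R A N₁]
  {f₀ : M₀ →ₗ[R] N₀} {f₁ : M₁ →ₗ[R] N₁}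

theorem map_mem_gammaSubmodule_map {y : M₀} (hy : y ∈ gammaSubmodule a M₀) :
    f₀ y ∈ gammaSubmodule (a.map (algebraMap R A)) N₀ := by
  obtain ⟨l, hl⟩ := hy
  refine ⟨l, fun r hr => ?_⟩
  rw [← Ideal.map_pow] at hr
  induction hr using Submodule.span_induction with
  | mem r hr =>
    obtain ⟨r, hr, rfl⟩ := hr
    rw [algebraMap_smul, ← map_smul, hl r hr, map_zero]
  | zero => exact zero_smul _ _
  | add u v _ _ hu hv => rw [add_smul, hu, hv, add_zero]
  | smul u v _ hv => rw [smul_assoc, hv, smul_zero]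

/-- A torsion preimage in a localized module lifts, up to denominators, to a torsion preimage. -/
theorem exists_mem_gammaSubmodule_map_eq_smul [IsNoetherianRing R]
    [IsLocalizedModule S f₀] [IsLocalizedModule S f₁] {d : M₀ →ₗ[R] M₁} {d' : N₀ →ₗ[A] N₁}
    (hd : ∀ x, d' (f₀ x) = f₁ (d x)) {y : M₁} {w : N₀}
    (hw : w ∈ gammaSubmodule (a.map (algebraMap R A)) N₀) (hdw : d' w = f₁ y) :
    ∃ s ∈ S, ∃ z ∈ gammaSubmodule a M₀, d z = s • y := by
  obtain ⟨l, hw⟩ := hw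
  obtain ⟨⟨z₀, s⟩, hz₀⟩ := IsLocalizedModule.surj S f₀ w
  replace hz₀ : (s : R) • w = f₀ z₀ := hz₀
  have hz₁ (x) (hx : x ∈ Submodule.map (LinearMap.toSpanSingleton R _ z₀) (a ^ l)) :
      ∃ t ∈ S, t • x = 0 := by
    obtain ⟨r, hr, rfl⟩ := hx
    have h1 : f₀ (r • z₀) = f₀ 0 := by
      rw [map_smul, map_zero, ← hz₀, smul_comm, ← algebraMap_smul A r w,
        hw _ (by rw [← Ideal.map_pow]; exact Ideal.mem_map_of_mem _ hr), smul_zero]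
    obtain ⟨t, ht⟩ := IsLocalizedModule.exists_of_eq (S := S) h1
    exact ⟨t, t.2, ht.trans (smul_zero _)⟩
  obtain ⟨t, ht, htz⟩ := exists_mem_smul_eq_zero_of_fg
    ((IsNoetherian.noetherian (a ^ l)).map _) hz₁
  have hz₂ : t • z₀ ∈ gammaSubmodule a M₀ :=
    ⟨l, fun r hr => by rw [smul_comm]; exact htz _ ⟨r, hr, rfl⟩⟩
  have hr (r : R) (x : N₀) : d' (r • x) = r • d' x := by
    rw [← algebraMap_smul A, map_smul, algebraMap_smul]
  have h2 : f₁ (d (t • z₀)) = f₁ ((t * s) • y) := by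
    rw [← hd, map_smul, ← hz₀, mul_smul, hr, hr, hdw, map_smul, map_smul]
  obtain ⟨u, hu⟩ := IsLocalizedModule.exists_of_eq (S := S) h2
  refine ⟨u * (t * s), S.mul_mem u.2 (S.mul_mem ht s.2), (u : R) • t • z₀,
    Submodule.smul_mem _ _ hz₂, ?_⟩
  rw [map_smul, mul_smul]
  exact hu

end LocalizedModule

section LocalizationFunctor

attribute [local instance] LocalizedModule.moduleOfIsLocalization

variable (S : Submonoid R) (A : Type u) [CommRing A] [Algebra R A] [IsLocalization S A]

/-- Localization at `S` as a functor to modules over an arbitrary model `A` of `S⁻¹R`. -/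
noncomputable def localizationFunctor : ModuleCat.{u} R ⥤ ModuleCat.{u} A where
  obj M := ModuleCat.of A (LocalizedModule S M)
  map {M N} f := ModuleCat.ofHom (IsLocalizedModule.mapExtendScalars S
    (LocalizedModule.mkLinearMap S M) (LocalizedModule.mkLinearMap S N) A f.hom)
  map_id M := ModuleCat.hom_ext (LinearMap.ext fun x => by
    change IsLocalizedModule.map S _ _ LinearMap.id x = x
    rw [IsLocalizedModule.map_id]
    rfl)
  map_comp {M N L} f g := ModuleCat.hom_ext (LinearMap.ext fun x => by
    change IsLocalizedModule.map S _ _ (g.hom ∘ₗ f.hom) x = _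
    rw [IsLocalizedModule.map_comp' S _ (LocalizedModule.mkLinearMap S N)]
    rfl)

instance localizationFunctor_additive : (localizationFunctor S A).Additive where
  map_add {M N f g} := ModuleCat.hom_ext (map_add (IsLocalizedModule.mapExtendScalars S
    (LocalizedModule.mkLinearMap S M) (LocalizedModule.mkLinearMap S N) A) f.hom g.hom)

instance localizationFunctor_preservesHomology : (localizationFunctor S A).PreservesHomology := by
  have := ((Functor.exact_tfae (localizationFunctor S A)).out 1 2).mp fun T hT => by
    rw [ShortComplex.ShortExact.moduleCat_exact_iff_function_exact] at hT ⊢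
    exact IsLocalizedModule.map_exact S (LocalizedModule.mkLinearMap S T.X₁)
      (LocalizedModule.mkLinearMap S T.X₂) (LocalizedModule.mkLinearMap S T.X₃) _ _ hT
  exact this

instance localizationFunctor_preservesInjectiveObjects [IsNoetherianRing R] :
    (localizationFunctor S A).PreservesInjectiveObjects where
  injective_obj {M} hM := by
    have : Module.Injective R M := Module.injective_module_of_injective_object R M
    have : Module.Injective A (LocalizedModule S M) :=
      Module.injective_of_isLocalizedModule S (LocalizedModule.mkLinearMap S M)
    exact Module.injective_object_of_injective_module A _

/-- Localization sends the free module of rank one to the free module of rank one. -/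
noncomputable def localizationFunctorObjSelf :
    (localizationFunctor S A).obj (ModuleCat.of R R) ≅ ModuleCat.of A A :=
  LinearEquiv.toModuleIso (LinearEquiv.extendScalarsOfIsLocalization S A
    (IsLocalizedModule.linearEquiv S (LocalizedModule.mkLinearMap S R) (Algebra.linearMap R A)))

/-- A cocycle of `Γ_a(E)` becomes a coboundary after multiplication by an element of `S`, if the
local cohomology of the localization at `S` vanishes. -/
theorem exists_smul_eq_coboundary [IsNoetherianRing R] (a : Ideal R)
    (E : InjectiveResolution (ModuleCat.of R R)) {i j k : ℕ}
    (hi : (ComplexShape.up ℕ).prev j = i) (hk : (ComplexShape.up ℕ).next j = k)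
    (h : Subsingleton (H (a.map (algebraMap R A)) j))
    {y : E.cocomplex.X j} (hy : y ∈ gammaSubmodule a (E.cocomplex.X j))
    (hdy : (E.cocomplex.d j k).hom y = 0) :
    ∃ s ∈ S, ∃ z ∈ gammaSubmodule a (E.cocomplex.X i), (E.cocomplex.d i j).hom z = s • y := by
  let F := localizationFunctor S A
  let b := a.map (algebraMap R A)
  let E' := mapInjectiveResolution F E
  let f (l : ℕ) : E.cocomplex.X l →ₗ[R] LocalizedModule S (E.cocomplex.X l) :=
    LocalizedModule.mkLinearMap S (E.cocomplex.X l)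
  let d' (l m : ℕ) : LocalizedModule S (E.cocomplex.X l) →ₗ[A]
    LocalizedModule S (E.cocomplex.X m) := (E'.cocomplex.d l m).hom
  have hf (l m : ℕ) (x) : d' l m (f l x) = f m ((E.cocomplex.d l m).hom x) :=
    IsLocalizedModule.map_apply S (f l) (f m) _ x
  obtain ⟨q, -, hq⟩ := exists_surjective_cocycles E' b hi hk
  have h' : Subsingleton ((localCohomologyFunctor b j).obj (F.obj (ModuleCat.of R R))) :=
    ((localCohomologyFunctor b j).mapIso
      (localizationFunctorObjSelf S A)).toLinearEquiv.toEquiv.subsingleton_congr.mpr h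
  have hfy : f j y ∈ gammaSubmodule b (LocalizedModule S (E.cocomplex.X j)) :=
    map_mem_gammaSubmodule_map hy
  have hdfy : d' j k (f j y) = 0 := by rw [hf, hdy, map_zero]
  obtain ⟨w, hw, hdw⟩ := (hq ⟨f j y, hfy, hdfy⟩).mp (h'.elim _ _)
  exact exists_mem_gammaSubmodule_map_eq_smul (hf i j) hw hdw

end LocalizationFunctor

/-- If `a` is locally a cohomological complete intersection on the punctured spectrum, then
`H^j_a(R)` is supported at the maximal ideal for `j` larger than the height of `a`. -/
theorem mem_gammaSubmodule_maximalIdeal [IsNoetherianRing R] [IsLocalRing R] {a : Ideal R}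
    (ha : IsLocallyCohomologicalCompleteIntersection a) {c : ℕ} (hc : a.height = c) {j : ℕ}
    (hj : c < j) (m : H a j) : m ∈ gammaSubmodule (maximalIdeal R) (H a j) := by
  let E : InjectiveResolution (ModuleCat.of R R) := InjectiveResolution.of _
  obtain ⟨q, hq, hq'⟩ := exists_surjective_cocycles E a (j := j) rfl rfl
  obtain ⟨⟨y, hy, hdy⟩, rfl⟩ := hq m
  refine mem_gammaSubmodule_maximalIdeal_of_forall_isPrime fun p hp hpm => ?_
  suffices ∃ s ∉ p, ∃ z ∈ gammaSubmodule a (E.cocomplex.X ((ComplexShape.up ℕ).prev j)),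
      (E.cocomplex.d ((ComplexShape.up ℕ).prev j) j).hom z = s • y by
    obtain ⟨s, hs, hz⟩ := this
    exact ⟨s, hs, by rw [← map_smul]; exact (hq' _).mpr hz⟩
  by_cases hap : a ≤ p
  · refine exists_smul_eq_coboundary p.primeCompl (Localization.AtPrime p) a E rfl rfl ?_ hy hdy
    by_contra hne
    have h1 := ha p hap hpm
    have h2 : ((j : ℕ∞) : WithBot ℕ∞) ≤
        cohomologicalDimension (a.map (algebraMap R (Localization.AtPrime p))) :=
      le_sSup ⟨j, not_subsingleton_iff_nontrivial.mp hne, rfl⟩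
    rw [h1, hc, WithBot.coe_le_coe, Nat.cast_le] at h2
    exact absurd h2 (not_le.mpr hj)
  · obtain ⟨s, hs, hsp⟩ := SetLike.not_le_iff_exists.mp hap
    obtain ⟨k, hk⟩ := hy
    exact ⟨s ^ k, fun h => hsp (hp.mem_of_pow_mem k h), 0, zero_mem _,
      by rw [map_zero, hk _ (Ideal.pow_mem_pow hs k)]⟩

section Gorenstein

variable [IsGorensteinLocalRing R] {n : ℕ}

theorem subsingleton_H_of_dim_lt (hn : ringKrullDim R = n) (a : Ideal R) {j : ℕ} (hj : n < j) :
    Subsingleton (H a j) :=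
  subsingleton_localCohomology a R j fun _ => extVanishes_of_dim_lt hn _ hj

theorem subsingleton_H_of_lt_height (hn : ringKrullDim R = n) {a : Ideal R} {c : ℕ}
    (hc : a.height = c) {j : ℕ} (hj : j < c) : Subsingleton (H a j) :=
  subsingleton_localCohomology a R j fun k => extVanishes_of_lt_height hn hc hj k _ fun r hr m => by
    obtain ⟨m, rfl⟩ := Ideal.Quotient.mk_surjective m
    exact Ideal.Quotient.eq_zero_iff_mem.mpr (Ideal.mul_mem_right m _ hr)

end Gorenstein

end LocCoh

/-! ### Torsion subcomplexes -/

namespace LocCoh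

variable {R : Type u} [CommRing R]

section GammaComplex

/-- The complex obtained by applying `Γ_a` to a complex of modules in each degree. -/
noncomputable abbrev gammaComplex (a : Ideal R) (K : CochainComplex (ModuleCat.{u} R) ℤ) :
    CochainComplex (ModuleCat.{u} R) ℤ :=
  ((gamma a).mapHomologicalComplex (.up ℤ)).obj K

/-- The inclusion `Γ_a(K) ⟶ K`. -/
noncomputable def gammaComplexι (a : Ideal R) (K : CochainComplex (ModuleCat.{u} R) ℤ) :
    gammaComplex a K ⟶ K where
  f i := ModuleCat.ofHom (gammaSubmodule a (K.X i)).subtype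
  comm' _ _ _ := rfl

/-- The inclusion `Γ_b(K) ⟶ Γ_a(K)` for `a ≤ b`. -/
noncomputable def gammaComplexMap {a b : Ideal R} (h : a ≤ b)
    (K : CochainComplex (ModuleCat.{u} R) ℤ) : gammaComplex b K ⟶ gammaComplex a K where
  f _ := ModuleCat.ofHom (Submodule.inclusion (gammaSubmodule_anti h))
  comm' _ _ _ := rfl

theorem gammaComplexMap_comp_ι {a b : Ideal R} (h : a ≤ b)
    (K : CochainComplex (ModuleCat.{u} R) ℤ) :
    gammaComplexMap h K ≫ gammaComplexι a K = gammaComplexι b K := rfl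

instance mono_gammaComplexι (a : Ideal R) (K : CochainComplex (ModuleCat.{u} R) ℤ) :
    Mono (gammaComplexι a K) := by
  have (i : ℤ) : Mono ((gammaComplexι a K).f i) :=
    (ModuleCat.mono_iff_injective _).mpr Subtype.val_injective
  exact HomologicalComplex.mono_of_mono_f _ this

instance mono_gammaComplexMap {a b : Ideal R} (h : a ≤ b)
    (K : CochainComplex (ModuleCat.{u} R) ℤ) : Mono (gammaComplexMap h K) := by
  have : Mono (gammaComplexMap h K ≫ gammaComplexι a K) := by
    rw [gammaComplexMap_comp_ι]
    infer_instance
  exact mono_of_mono _ (gammaComplexι a K)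

instance isIso_gammaComplexι_bot (K : CochainComplex (ModuleCat.{u} R) ℤ) :
    IsIso (gammaComplexι ⊥ K) := by
  have (i : ℤ) : IsIso ((gammaComplexι ⊥ K).f i) := by
    rw [ConcreteCategory.isIso_iff_bijective]
    refine ⟨Subtype.val_injective, fun x => ⟨⟨x, ?_⟩, rfl⟩⟩
    rw [gammaSubmodule_bot]
    trivial
  exact HomologicalComplex.Hom.isIso_of_components _

theorem comp_conj_eq {C : Type*} [Category* C] {A₁ A₂ B₁ B₂ D₁ D₂ : C} (e₁ : A₁ ≅ B₁) (e₂ : A₂ ≅ B₂)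
    (x₁ : D₁ ≅ B₁) (x₂ : D₂ ≅ B₂) (d : B₁ ⟶ B₂) :
    (e₁ ≪≫ x₁.symm).hom ≫ x₁.hom ≫ d ≫ x₂.inv =
      (e₁.hom ≫ d ≫ e₂.inv) ≫ (e₂ ≪≫ x₂.symm).hom := by
  simp

/-- Applying `Γ_a` commutes with extending a resolution by zero to negative degrees. -/
noncomputable def extendGammaIso (a : Ideal R) {M : ModuleCat.{u} R} (E : InjectiveResolution M) :
    gammaComplex a E.cochainComplex ≅
      (((gamma a).mapHomologicalComplex (.up ℕ)).obj E.cocomplex).extend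
        ComplexShape.embeddingUpNat :=
  HomologicalComplex.Hom.isoOfComponents (fun i => match i with
    | Int.ofNat k => (gamma a).mapIso (E.cochainComplexXIso k k rfl) ≪≫
        (HomologicalComplex.extendXIso (((gamma a).mapHomologicalComplex (.up ℕ)).obj E.cocomplex)
          ComplexShape.embeddingUpNat (i' := Int.ofNat k) (i := k) rfl).symm
    | Int.negSucc k => Limits.IsZero.iso
        ((gamma a).map_isZero (CochainComplex.isZero_of_isStrictlyGE _ 0 _ (by lia)))
        (HomologicalComplex.isZero_extend_X _ _ _ (by simp)))
    fun i j hij => by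
      obtain k | k := i
      · obtain rfl : Int.ofNat (k + 1) = j := hij
        have h1 : (gammaComplex a E.cochainComplex).d (Int.ofNat k) (Int.ofNat (k + 1)) =
            (gamma a).map ((E.cochainComplexXIso k k rfl).hom) ≫
              (gamma a).map (E.cocomplex.d k (k + 1)) ≫
                (gamma a).map ((E.cochainComplexXIso (k + 1 : ℕ) (k + 1) rfl).inv) := by
          rw [← Functor.map_comp, ← Functor.map_comp, ← E.cochainComplex_d]
          rfl
        have h2 := HomologicalComplex.extend_d_eq
          (((gamma a).mapHomologicalComplex (.up ℕ)).obj E.cocomplex) ComplexShape.embeddingUpNat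
          (i' := Int.ofNat k) (j' := Int.ofNat (k + 1)) (i := k) (j := k + 1) rfl rfl
        exact (congrArg (_ ≫ ·) h2).trans ((comp_conj_eq ((gamma a).mapIso _)
          ((gamma a).mapIso (E.cochainComplexXIso (k + 1 : ℕ) (k + 1) rfl)) _ _ _).trans
          (congrArg (· ≫ _) h1.symm))
      · exact Limits.IsZero.eq_of_src
          ((gamma a).map_isZero (CochainComplex.isZero_of_isStrictlyGE _ 0 _ (by lia))) _ _

/-- The cohomology of the `ℤ`-indexed complex `Γ_a(E)` is local cohomology. -/
noncomputable def homologyGammaComplexIso (a : Ideal R) {M : ModuleCat.{u} R}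
    (E : InjectiveResolution M) (j : ℕ) :
    (gammaComplex a E.cochainComplex).homology j ≅ (localCohomologyFunctor a j).obj M :=
  HomologicalComplex.homologyMapIso (extendGammaIso a E) j ≪≫
    HomologicalComplex.extendHomologyIso _ ComplexShape.embeddingUpNat (j := j) rfl ≪≫
    (E.isoRightDerivedObj (gamma a) j).symm

instance isStrictlyGE_gammaComplex (a : Ideal R) {M : ModuleCat.{u} R}
    (E : InjectiveResolution M) : (gammaComplex a E.cochainComplex).IsStrictlyGE 0 := by
  rw [CochainComplex.isStrictlyGE_iff]
  intro i hi
  exact (gamma a).map_isZero (CochainComplex.isZero_of_isStrictlyGE _ 0 _ hi)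

instance injective_gammaComplex_X [IsNoetherianRing R] (a : Ideal R)
    (K : CochainComplex (ModuleCat.{u} R) ℤ) (i : ℤ) [Injective (K.X i)] :
    Injective ((gammaComplex a K).X i) := by
  have : Module.Injective R (K.X i) := Module.injective_module_of_injective_object R (K.X i)
  have : Module.Injective R (gammaSubmodule a (K.X i)) := injective_gammaSubmodule a
  exact Module.injective_object_of_injective_module R _

/-- The short exact sequence `0 ⟶ Γ_b(K) ⟶ Γ_a(K) ⟶ Γ_a(K) / Γ_b(K) ⟶ 0`. -/
noncomputable def gammaShortComplex {a b : Ideal R} (h : a ≤ b)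
    (K : CochainComplex (ModuleCat.{u} R) ℤ) : ShortComplex (CochainComplex (ModuleCat.{u} R) ℤ) :=
  ShortComplex.mk (gammaComplexMap h K) (Limits.cokernel.π _) (Limits.cokernel.condition _)

theorem gammaShortComplex_shortExact {a b : Ideal R} (h : a ≤ b)
    (K : CochainComplex (ModuleCat.{u} R) ℤ) : (gammaShortComplex h K).ShortExact where
  exact := ShortComplex.exact_cokernel _
  mono_f := mono_gammaComplexMap h K
  epi_g := by dsimp only [gammaShortComplex]; infer_instance

/-- The projection `Γ_a(K) ⟶ Γ_a(K) / Γ_b(K)` in degree `i`. -/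
noncomputable def gammaProj {a b : Ideal R} (h : a ≤ b)
    (K : CochainComplex (ModuleCat.{u} R) ℤ) (i : ℤ) :
    gammaSubmodule a (K.X i) →ₗ[R] (gammaShortComplex h K).X₃.X i :=
  ((gammaShortComplex h K).g.f i).hom

theorem gammaProj_surjective {a b : Ideal R} (h : a ≤ b)
    (K : CochainComplex (ModuleCat.{u} R) ℤ) (i : ℤ) : Function.Surjective (gammaProj h K i) :=
  ((gammaShortComplex_shortExact h K).map_of_exact
    (HomologicalComplex.eval _ _ i)).moduleCat_surjective_g

theorem gammaProj_eq_zero_iff {a b : Ideal R} (h : a ≤ b)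
    (K : CochainComplex (ModuleCat.{u} R) ℤ) (i : ℤ) (y : gammaSubmodule a (K.X i)) :
    gammaProj h K i y = 0 ↔ (y : K.X i) ∈ gammaSubmodule b (K.X i) := by
  have h1 := ((ShortComplex.ShortExact.moduleCat_exact_iff_function_exact _).mp
    ((gammaShortComplex_shortExact h K).map_of_exact (HomologicalComplex.eval _ _ i)).exact) y
  refine h1.trans ⟨?_, fun hy => ⟨⟨y.1, hy⟩, rfl⟩⟩
  rintro ⟨z, rfl⟩
  exact Subtype.property (p := (· ∈ gammaSubmodule b (K.X i))) z

/-- For injective `K`, multiplication by `x` is bijective on `Γ_a(K) / Γ_{(a, x)}(K)`. -/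
theorem bijective_smul_gammaShortComplex_X₃ [IsNoetherianRing R] {a b : Ideal R} (h : a ≤ b) (x : R)
    (hb : b = a ⊔ Ideal.span {x}) (K : CochainComplex (ModuleCat.{u} R) ℤ) (i : ℤ)
    [Injective (K.X i)] :
    Function.Bijective fun m : (gammaShortComplex h K).X₃.X i => x • m := by
  subst hb
  have : Module.Injective R (K.X i) := Module.injective_module_of_injective_object R (K.X i)
  constructor
  · refine (injective_iff_map_eq_zero (LinearMap.lsmul R _ x)).mpr fun m hm => ?_
    obtain ⟨y, rfl⟩ := gammaProj_surjective h K i m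
    replace hm : x • gammaProj h K i y = 0 := hm
    rw [← map_smul, gammaProj_eq_zero_iff] at hm
    exact (gammaProj_eq_zero_iff h K i y).mpr (mem_gammaSubmodule_of_smul_mem y.2 hm)
  · intro m
    obtain ⟨y, rfl⟩ := gammaProj_surjective h K i m
    obtain ⟨z, hz, hyz⟩ := exists_sub_smul_mem_gammaSubmodule a x y.2
    refine ⟨gammaProj h K i ⟨z, hz⟩, ?_⟩
    have h1 : gammaProj h K i (y - x • ⟨z, hz⟩) = 0 := (gammaProj_eq_zero_iff h K i _).mpr hyz
    rw [map_sub, map_smul, sub_eq_zero] at h1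
    exact h1.symm

/-- `Γ_0(K) / Γ_a(K)` has no `a`-torsion. -/
theorem eq_zero_of_mem_gammaSubmodule_X₃ [IsNoetherianRing R] (a : Ideal R)
    (K : CochainComplex (ModuleCat.{u} R) ℤ) (i : ℤ)
    {m : (gammaShortComplex (bot_le : ⊥ ≤ a) K).X₃.X i}
    (hm : m ∈ gammaSubmodule a ((gammaShortComplex (bot_le : ⊥ ≤ a) K).X₃.X i)) : m = 0 := by
  obtain ⟨k, hk⟩ := hm
  obtain ⟨y, rfl⟩ := gammaProj_surjective (bot_le : ⊥ ≤ a) K i m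
  refine (gammaProj_eq_zero_iff _ K i y).mpr (mem_gammaSubmodule_of_forall_smul_mem (k := k)
    fun r hr => ?_)
  exact (gammaProj_eq_zero_iff _ K i (r • y)).mp ((map_smul _ r y).trans (hk r hr))

theorem injective_gammaShortComplex_X₃ [IsNoetherianRing R] {a b : Ideal R} (h : a ≤ b)
    (K : CochainComplex (ModuleCat.{u} R) ℤ) (i : ℤ) [Injective (K.X i)] :
    Injective ((gammaShortComplex h K).X₃.X i) := by
  have h0 := (gammaShortComplex_shortExact h K).map_of_exact (HomologicalComplex.eval _ _ i)
  have h1 : HasInjectiveDimensionLT ((gammaComplex b K).X i) 1 :=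
    injective_iff_hasInjectiveDimensionLT_one.mp (injective_gammaComplex_X b K i)
  have h2 : HasInjectiveDimensionLT ((gammaComplex a K).X i) 1 :=
    injective_iff_hasInjectiveDimensionLT_one.mp (injective_gammaComplex_X a K i)
  rw [injective_iff_hasInjectiveDimensionLT_one]
  have h3 : HasInjectiveDimensionLT ((gammaComplex b K).X i) 2 :=
    hasInjectiveDimensionLT_of_ge _ 1 2 (by lia)
  exact h0.hasInjectiveDimensionLT_X₃ 1 h2 h3

instance isStrictlyGE_gammaShortComplex_X₃ {a b : Ideal R} (h : a ≤ b) {M : ModuleCat.{u} R}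
    (E : InjectiveResolution M) : (gammaShortComplex h E.cochainComplex).X₃.IsStrictlyGE 0 := by
  rw [CochainComplex.isStrictlyGE_iff]
  intro i hi
  rw [ModuleCat.isZero_iff_subsingleton]
  have : Subsingleton (gammaSubmodule a (E.cochainComplex.X i)) :=
    ModuleCat.isZero_iff_subsingleton.mp
      (CochainComplex.isZero_of_isStrictlyGE (gammaComplex a E.cochainComplex) 0 i hi)
  exact (gammaProj_surjective h E.cochainComplex i).subsingleton

instance isKInjective_gammaShortComplex_X₃ [IsNoetherianRing R] {a b : Ideal R} (h : a ≤ b)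
    {M : ModuleCat.{u} R} (E : InjectiveResolution M) :
    (gammaShortComplex h E.cochainComplex).X₃.IsKInjective := by
  have (i : ℤ) : Injective ((gammaShortComplex h E.cochainComplex).X₃.X i) :=
    injective_gammaShortComplex_X₃ h _ i
  exact CochainComplex.isKInjective_of_injective _ 0

end GammaComplex
end LocCoh

/-! ### Bounded objects of the derived category -/

namespace LocCoh

theorem eq_zero_of_iso_hom_comp {C : Type*} [Category* C] [Limits.HasZeroMorphisms C] {X Y Z : C}
    (e : X ≅ Y) {g : Y ⟶ Z} (h : e.hom ≫ g = 0) : g = 0 := by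
  rw [← e.inv_hom_id_assoc g, h, Limits.comp_zero]

section Devissage

open Pretriangulated DerivedCategory DerivedCategory.TStructure

variable {C : Type u} [Category.{v} C] [Abelian C] [HasDerivedCategory.{w} C]

theorem isIso_homologyMap_truncLTι (K : DerivedCategory C) {i n : ℤ} (hi : i < n) :
    IsIso ((homologyFunctor C i).map ((t.truncLTι n).app K)) := by
  have hT := t.triangleLTGE_distinguished n K
  have h1 : Mono ((homologyFunctor C i).map ((t.truncLTι n).app K)) :=
    (HomologySequence.mono_homologyMap_mor₁_iff _ hT (i - 1) i).mpr
      ((isZero_of_isGE ((t.truncGE n).obj K) n (i - 1) (by lia)).eq_of_src _ _)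
  have h2 : Epi ((homologyFunctor C i).map ((t.truncLTι n).app K)) :=
    (HomologySequence.epi_homologyMap_mor₁_iff _ hT i).mpr
      ((isZero_of_isGE ((t.truncGE n).obj K) n i (by lia)).eq_of_tgt _ _)
  exact isIso_of_mono_of_epi _

theorem isIso_homologyMap_truncGEπ (K : DerivedCategory C) {i n : ℤ} (hi : n ≤ i) :
    IsIso ((homologyFunctor C i).map ((t.truncGEπ n).app K)) := by
  have hT := t.triangleLTGE_distinguished n K
  have h1 : Epi ((homologyFunctor C i).map ((t.truncGEπ n).app K)) :=
    (HomologySequence.epi_homologyMap_mor₂_iff _ hT i (i + 1)).mpr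
      ((isZero_of_isLE ((t.truncLT n).obj K) (n - 1) (i + 1) (by lia)).eq_of_tgt _ _)
  have h2 : Mono ((homologyFunctor C i).map ((t.truncGEπ n).app K)) :=
    (HomologySequence.mono_homologyMap_mor₂_iff _ hT i).mpr
      ((isZero_of_isLE ((t.truncLT n).obj K) (n - 1) i (by lia)).eq_of_src _ _)
  exact isIso_of_mono_of_epi _

/-- The bounded objects of the derived category all of whose cohomology objects satisfy `P`. -/
structure BoundedWith (P : ObjectProperty C) (K : DerivedCategory C) : Prop where
  isGE : ∃ l : ℤ, K.IsGE l
  isLE : ∃ l : ℤ, K.IsLE l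
  homology : ∀ i : ℤ, P ((homologyFunctor C i).obj K)

namespace BoundedWith

variable {P : ObjectProperty C} [P.IsClosedUnderIsomorphisms] {K : DerivedCategory C}

theorem shift (hK : BoundedWith P K) (j : ℤ) : BoundedWith P (K⟦j⟧) where
  isGE := by
    obtain ⟨l, _⟩ := hK.isGE
    exact ⟨l - j, t.isGE_shift K l j (l - j)⟩
  isLE := by
    obtain ⟨l, _⟩ := hK.isLE
    exact ⟨l - j, t.isLE_shift K l j (l - j)⟩
  homology i := P.prop_of_iso
    (((homologyFunctor C 0).shiftIso j i (j + i) rfl).symm.app K) (hK.homology (j + i))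

theorem exists_iso_single (hK : BoundedWith P K) (n : ℤ) [K.IsGE n] [K.IsLE n] :
    ∃ N : C, P N ∧ Nonempty (K ≅ (singleFunctor C n).obj N) := by
  obtain ⟨N, ⟨e⟩⟩ := K.exists_iso_singleFunctor_obj_of_isGE_of_isLE n
  exact ⟨N, P.prop_of_iso ((homologyFunctor C n).mapIso e ≪≫
    (singleFunctorCompHomologyFunctorIso C n).app N) (hK.homology n), ⟨e⟩⟩

variable [P.ContainsZero]

theorem truncLT (hK : BoundedWith P K) (n : ℤ) : BoundedWith P ((t.truncLT n).obj K) where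
  isGE := by
    obtain ⟨l, _⟩ := hK.isGE
    exact ⟨l, inferInstance⟩
  isLE := ⟨n - 1, inferInstance⟩
  homology i := by
    by_cases hi : i < n
    · have := isIso_homologyMap_truncLTι K hi
      exact P.prop_of_iso (asIso ((homologyFunctor C i).map ((t.truncLTι n).app K))).symm
        (hK.homology i)
    · exact P.prop_of_isZero (isZero_of_isLE _ (n - 1) i (by lia))

theorem truncGE (hK : BoundedWith P K) (n : ℤ) : BoundedWith P ((t.truncGE n).obj K) where
  isGE := ⟨n, inferInstance⟩
  isLE := by
    obtain ⟨l, _⟩ := hK.isLE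
    exact ⟨l, inferInstance⟩
  homology i := by
    by_cases hi : n ≤ i
    · have := isIso_homologyMap_truncGEπ K hi
      exact P.prop_of_iso (asIso ((homologyFunctor C i).map ((t.truncGEπ n).app K)))
        (hK.homology i)
    · exact P.prop_of_isZero (isZero_of_isGE _ n i (by lia))

/-- A bounded object has no nonzero morphism to `Y` if its shifted cohomology objects have none. -/
theorem hom_eq_zero (hK : BoundedWith P K) {Y : DerivedCategory C}
    (hY : ∀ (i : ℤ) (N : C), P N → ∀ f : (singleFunctor C i).obj N ⟶ Y, f = 0) (f : K ⟶ Y) :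
    f = 0 := by
  obtain ⟨a, ha⟩ := hK.isGE
  suffices ∀ (m : ℕ) (K : DerivedCategory C), BoundedWith P K → K.IsGE a → K.IsLE (a + m - 1) →
      ∀ f : K ⟶ Y, f = 0 by
    obtain ⟨b, hb⟩ := hK.isLE
    exact this (b - a + 1).toNat K hK ha (t.isLE_of_le K b _ (by lia)) f
  intro m
  induction m with
  | zero =>
    intro K _ _ _ f
    exact (t.isZero K (a + (0 : ℕ) - 1) a (by lia)).eq_of_src _ _
  | succ m ih =>
    intro K hK _ hle f
    have hT := t.triangleLTGE_distinguished (a + m) K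
    have h1 : (t.truncLTι (a + m)).app K ≫ f = 0 :=
      ih _ (hK.truncLT _) inferInstance inferInstance _
    obtain ⟨g, rfl⟩ := Triangle.yoneda_exact₂ _ hT f h1
    have : K.IsLE (a + m) := t.isLE_of_le K (a + (m + 1 : ℕ) - 1) _ (by lia)
    obtain ⟨N, hN, ⟨e⟩⟩ := (hK.truncGE (a + m)).exists_iso_single (a + m)
    have hg : g = 0 := eq_zero_of_iso_hom_comp e.symm (hY _ N hN _)
    rw [hg]
    exact Limits.comp_zero

end BoundedWith

/-- Vanishing of morphisms to a K-injective complex can be checked degreewise, since morphisms in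
the derived category to such a complex come from morphisms of complexes. -/
theorem single_hom_Q_eq_zero (L : CochainComplex C ℤ) [L.IsKInjective] (i : ℤ) (N : C)
    (h : ∀ g : N ⟶ L.X i, g = 0) (f : (singleFunctor C i).obj N ⟶ Q.obj L) : f = 0 := by
  let X := (CochainComplex.singleFunctor C i).obj N
  let e : (singleFunctor C i).obj N ≅ Q.obj X := (singleFunctorIsoCompQ C i).app N
  obtain ⟨g, hg⟩ := (CochainComplex.IsKInjective.Qh_map_bijective
    ((HomotopyCategory.quotient C (.up ℤ)).obj X) L).2
    ((quotientCompQhIso C).hom.app X ≫ (e.inv ≫ f) ≫ (quotientCompQhIso C).inv.app L)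
  obtain ⟨g, rfl⟩ := (HomotopyCategory.quotient C (.up ℤ)).map_surjective g
  have h0 : g = 0 := HomologicalComplex.from_single_hom_ext
    (eq_zero_of_iso_hom_comp (HomologicalComplex.singleObjXSelf (.up ℤ) i N).symm (h _))
  rw [h0, Functor.map_zero, Functor.map_zero] at hg
  have h1 := hg.symm
  rw [Preadditive.IsIso.comp_left_eq_zero, Preadditive.IsIso.comp_right_eq_zero,
    Preadditive.IsIso.comp_left_eq_zero] at h1
  exact h1

end Devissage

section Ext

open DerivedCategory

variable {R : Type u} [CommRing R] [HasDerivedCategory.{w} (ModuleCat.{u} R)]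

theorem extVanishes_iff_forall_single_hom (M N : Type u) [AddCommGroup M] [Module R M]
    [AddCommGroup N] [Module R N] (i : ℕ) : ExtVanishes R M N i ↔
    ∀ f : (singleFunctor (ModuleCat.{u} R) i).obj (ModuleCat.of R M) ⟶
      (singleFunctor (ModuleCat.{u} R) 0).obj (ModuleCat.of R N), f = 0 := by
  let e : ((singleFunctor (ModuleCat.{u} R) i).obj (ModuleCat.of R M))⟦(i : ℤ)⟧ ≅
      (singleFunctor (ModuleCat.{u} R) 0).obj (ModuleCat.of R M) :=
    ((singleFunctors (ModuleCat.{u} R)).shiftIso i 0 i (by simp)).app _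
  rw [extVanishes_iff_forall_eq_zero]
  constructor
  · intro h f
    have h1 := h (Ext.homAddEquiv.symm (e.inv ≫ f⟦(i : ℤ)⟧'))
    rw [EmbeddingLike.map_eq_zero_iff, Preadditive.IsIso.comp_left_eq_zero] at h1
    exact (shiftFunctor _ (i : ℤ)).map_injective (h1.trans (Functor.map_zero _ _ _).symm)
  · intro h x
    obtain ⟨f, hf⟩ := (shiftFunctor (DerivedCategory (ModuleCat.{u} R)) (i : ℤ)).map_surjective
      (e.hom ≫ Ext.homAddEquiv x)
    rw [h f, Functor.map_zero] at hf
    have h1 := hf.symm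
    rw [Preadditive.IsIso.comp_left_eq_zero] at h1
    exact Ext.homAddEquiv.injective (h1.trans (map_zero _).symm)

end Ext

end LocCoh

/-! ### Derived torsion functors -/

namespace LocCoh

section Triangles

open Pretriangulated

variable {D : Type*} [Category* D] [Limits.HasZeroObject D] [HasShift D ℤ] [Preadditive D]
  [∀ n : ℤ, (shiftFunctor D n).Additive] [Pretriangulated D]
  {X Y Z V : D} {f : X ⟶ Y} {g : Y ⟶ Z} {δ : Z ⟶ X⟦(1 : ℤ)⟧}

theorem injective_precomp_of_distinguished (hT : Triangle.mk f g δ ∈ distTriang D)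
    (hZ : ∀ u : Z ⟶ V, u = 0) : Function.Injective fun u : Y ⟶ V => f ≫ u := by
  intro u v huv
  replace huv : f ≫ u = f ≫ v := huv
  obtain ⟨w, hw⟩ := Triangle.yoneda_exact₂ _ hT (u - v) (by
    change f ≫ (u - v) = 0
    rw [Preadditive.comp_sub, huv, sub_self])
  exact sub_eq_zero.mp (hw.trans ((congrArg (g ≫ ·) (hZ w)).trans Limits.comp_zero))

theorem surjective_precomp_of_distinguished (hT : Triangle.mk f g δ ∈ distTriang D)
    (hZ : ∀ u : Z⟦(-1 : ℤ)⟧ ⟶ V, u = 0) : Function.Surjective fun u : Y ⟶ V => f ≫ u := by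
  intro u
  obtain ⟨w, hw⟩ := Triangle.yoneda_exact₂ _ (inv_rot_of_distTriang _ hT) u (hZ _)
  exact ⟨w, hw.symm⟩

theorem hom_eq_zero_of_injective_precomp (hT : Triangle.mk f g δ ∈ distTriang D)
    (hf : Function.Injective fun u : Y ⟶ V => f ≫ u) (hX : ∀ u : X⟦(1 : ℤ)⟧ ⟶ V, u = 0)
    (u : Z ⟶ V) : u = 0 := by
  have hfg : f ≫ g = 0 := comp_distTriang_mor_zero₁₂ _ hT
  have hgu : g ≫ u = 0 := hf (by
    change f ≫ g ≫ u = f ≫ 0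
    rw [reassoc_of% hfg, Limits.zero_comp, Limits.comp_zero])
  obtain ⟨w, hw⟩ := Triangle.yoneda_exact₃ _ hT u hgu
  exact hw.trans ((congrArg (δ ≫ ·) (hX w)).trans Limits.comp_zero)

theorem hom_shift_eq_zero_of_surjective_precomp (hT : Triangle.mk f g δ ∈ distTriang D)
    (hf : Function.Surjective fun u : Y ⟶ V => f ≫ u) (hY : ∀ u : Y⟦(-1 : ℤ)⟧ ⟶ V, u = 0)
    (u : Z⟦(-1 : ℤ)⟧ ⟶ V) : u = 0 := by
  have hT' := inv_rot_of_distTriang _ hT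
  obtain ⟨w, hw⟩ := Triangle.yoneda_exact₂ _ (inv_rot_of_distTriang _ hT') u (hY _)
  obtain ⟨w, rfl⟩ := hf w
  have h0 := comp_distTriang_mor_zero₁₂ _ hT'
  exact hw.trans ((Category.assoc _ _ _).symm.trans ((congrArg (· ≫ w) h0).trans Limits.zero_comp))

end Triangles

variable {R : Type u} [CommRing R]

/-- The modules all of whose elements are annihilated by a power of `a`. -/
def torsionModules (a : Ideal R) : ObjectProperty (ModuleCat.{u} R) :=
  fun N => ∀ x : N, x ∈ gammaSubmodule a N

instance torsionModules_isClosedUnderIsomorphisms (a : Ideal R) :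
    (torsionModules a).IsClosedUnderIsomorphisms where
  of_iso e h x := by
    have := map_mem_gammaSubmodule a e.hom.hom _ (h (e.inv.hom x))
    rwa [show e.hom.hom (e.inv.hom x) = x from e.toLinearEquiv.apply_symm_apply x] at this

instance torsionModules_containsZero (a : Ideal R) : (torsionModules a).ContainsZero where
  exists_zero := ⟨ModuleCat.of R PUnit, ModuleCat.isZero_of_subsingleton _, fun _ => zero_mem _⟩

/-- The modules on which multiplication by `x` is bijective. -/
def bijectiveSMulModules (x : R) : ObjectProperty (ModuleCat.{u} R) :=
  fun N => Function.Bijective fun m : N => x • m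

instance bijectiveSMulModules_isClosedUnderIsomorphisms (x : R) :
    (bijectiveSMulModules x).IsClosedUnderIsomorphisms where
  of_iso {M N} e h := by
    have h1 : (fun m : N => x • m) = e.hom.hom ∘ (fun m : M => x • m) ∘ e.inv.hom := by
      ext m
      change x • m = e.hom.hom (x • e.inv.hom m)
      rw [map_smul]
      exact congrArg (x • ·) (e.toLinearEquiv.apply_symm_apply m).symm
    change Function.Bijective fun m : N => x • m
    rw [h1]
    exact e.toLinearEquiv.bijective.comp (h.comp e.toLinearEquiv.symm.bijective)

instance bijectiveSMulModules_containsZero (x : R) : (bijectiveSMulModules x).ContainsZero where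
  exists_zero := ⟨ModuleCat.of R PUnit, ModuleCat.isZero_of_subsingleton _,
    fun _ _ _ => rfl, fun y => ⟨y, rfl⟩⟩

theorem torsionModules_localCohomology {M : ModuleCat.{u} R} (a : Ideal R) (j : ℕ) :
    torsionModules a ((localCohomologyFunctor a j).obj M) := fun m => by
  obtain ⟨q, hq, -⟩ := exists_surjective_cocycles (InjectiveResolution.of M) a (j := j) rfl rfl
  obtain ⟨⟨y, ⟨k, hk⟩, hdy⟩, rfl⟩ := hq m
  refine ⟨k, fun r hr => ?_⟩
  rw [← map_smul]
  have : r • (⟨y, ⟨k, hk⟩, hdy⟩ : ↥(gammaSubmodule a _ ⊓ LinearMap.ker _)) = 0 :=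
    Subtype.ext (hk r hr)
  rw [this, map_zero]

variable [HasDerivedCategory.{w} (ModuleCat.{u} R)]

open Pretriangulated DerivedCategory DerivedCategory.TStructure

section DerivedGamma

variable {M : ModuleCat.{u} R} (E : InjectiveResolution M)

/-- The object `RΓ_a(M)` of the derived category, represented by `Γ_a(E)`. -/
noncomputable def derivedGamma (a : Ideal R) : DerivedCategory (ModuleCat.{u} R) :=
  Q.obj (gammaComplex a E.cochainComplex)

/-- The morphism `RΓ_b(M) ⟶ RΓ_a(M)` for `a ≤ b`. -/
noncomputable def derivedGammaMap {a b : Ideal R} (h : a ≤ b) :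
    derivedGamma E b ⟶ derivedGamma E a :=
  Q.map (gammaComplexMap h E.cochainComplex)

theorem derivedGammaMap_comp {a b c : Ideal R} (h : a ≤ b) (h' : b ≤ c) :
    derivedGammaMap E h' ≫ derivedGammaMap E h = derivedGammaMap E (h.trans h') :=
  (Q.map_comp _ _).symm

/-- `RΓ_0(M)` is `M`. -/
noncomputable def derivedGammaBotIso :
    derivedGamma E ⊥ ≅ (singleFunctor (ModuleCat.{u} R) 0).obj M :=
  Q.mapIso (asIso (gammaComplexι ⊥ E.cochainComplex)) ≪≫ (asIso (Q.map E.ι')).symm ≪≫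
    ((singleFunctorIsoCompQ (ModuleCat.{u} R) 0).app M).symm

/-- The cone of `RΓ_b(M) ⟶ RΓ_a(M)`. -/
noncomputable def derivedGammaCone {a b : Ideal R} (h : a ≤ b) :
    DerivedCategory (ModuleCat.{u} R) :=
  Q.obj (gammaShortComplex h E.cochainComplex).X₃

/-- The distinguished triangle `RΓ_b(M) ⟶ RΓ_a(M) ⟶ derivedGammaCone ⟶ RΓ_b(M)⟦1⟧`. -/
theorem exists_derivedGamma_triangle {a b : Ideal R} (h : a ≤ b) :
    ∃ (g : derivedGamma E a ⟶ derivedGammaCone E h)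
      (δ : derivedGammaCone E h ⟶ (derivedGamma E b)⟦(1 : ℤ)⟧),
      Triangle.mk (derivedGammaMap E h) g δ ∈ distTriang _ :=
  ⟨_, _, triangleOfSES_distinguished (gammaShortComplex_shortExact h E.cochainComplex)⟩

/-- The cohomology of `RΓ_a(M)` is local cohomology. -/
noncomputable def homologyDerivedGammaIso (a : Ideal R) (j : ℕ) :
    (homologyFunctor (ModuleCat.{u} R) j).obj (derivedGamma E a) ≅
      (localCohomologyFunctor a j).obj M :=
  (homologyFunctorFactors (ModuleCat.{u} R) j).app _ ≪≫ homologyGammaComplexIso a E j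

theorem derivedGamma_isGE (a : Ideal R) {c : ℕ}
    (h : ∀ j < c, Subsingleton ((localCohomologyFunctor a j).obj M)) :
    (derivedGamma E a).IsGE c := by
  rw [isGE_iff]
  intro i hi
  obtain ⟨j, rfl⟩ | hj : (∃ j : ℕ, i = j) ∨ i < 0 := by
    obtain hi | hi := le_or_gt 0 i
    · exact Or.inl ⟨i.toNat, by lia⟩
    · exact Or.inr hi
  · exact (ModuleCat.isZero_iff_subsingleton.mpr (h j (by lia))).of_iso
      (homologyDerivedGammaIso E a j)
  · have : (derivedGamma E a).IsGE 0 := by dsimp only [derivedGamma]; infer_instance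
    exact isZero_of_isGE _ 0 i hj

theorem derivedGamma_isLE (a : Ideal R) {n : ℕ}
    (h : ∀ j > n, Subsingleton ((localCohomologyFunctor a j).obj M)) :
    (derivedGamma E a).IsLE n := by
  rw [isLE_iff]
  intro i hi
  obtain ⟨j, rfl⟩ : ∃ j : ℕ, i = j := ⟨i.toNat, by lia⟩
  exact (ModuleCat.isZero_iff_subsingleton.mpr (h j (by lia))).of_iso
      (homologyDerivedGammaIso E a j)

theorem derivedGammaCone_isGE {a b : Ideal R} (h : a ≤ b) : (derivedGammaCone E h).IsGE 0 := by
  dsimp only [derivedGammaCone]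
  infer_instance

/-- The cohomology of `RΓ_a(M)` is `a`-torsion. -/
theorem boundedWith_torsionModules_derivedGamma (a : Ideal R) {n : ℕ}
    (h : ∀ j > n, Subsingleton ((localCohomologyFunctor a j).obj M)) :
    BoundedWith (torsionModules a) (derivedGamma E a) where
  isGE := ⟨0, derivedGamma_isGE E a (c := 0) (by simp)⟩
  isLE := ⟨n, derivedGamma_isLE E a h⟩
  homology i := by
    obtain ⟨j, rfl⟩ | hj : (∃ j : ℕ, i = j) ∨ i < 0 := by
      obtain hi | hi := le_or_gt 0 i
      · exact Or.inl ⟨i.toNat, by lia⟩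
      · exact Or.inr hi
    · exact (torsionModules a).prop_of_iso (homologyDerivedGammaIso E a j).symm
        (torsionModules_localCohomology a j)
    · have : (derivedGamma E a).IsGE (0 : ℕ) := derivedGamma_isGE E a (c := 0) (by simp)
      exact (torsionModules a).prop_of_isZero (isZero_of_isGE _ (0 : ℕ) i (by lia))

variable [IsNoetherianRing R]

/-- `a`-torsion objects have no morphisms to the cone of `RΓ_a(M) ⟶ M`. -/
theorem BoundedWith.hom_derivedGammaCone_eq_zero {a : Ideal R}
    {K : DerivedCategory (ModuleCat.{u} R)}
    (hK : BoundedWith (torsionModules a) K)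
    (f : K ⟶ derivedGammaCone E (bot_le : ⊥ ≤ a)) : f = 0 := by
  refine hK.hom_eq_zero (fun i N hN f => single_hom_Q_eq_zero _ i N (fun g => ?_) f) f
  refine ModuleCat.hom_ext (LinearMap.ext fun x => ?_)
  exact eq_zero_of_mem_gammaSubmodule_X₃ a E.cochainComplex i
    (map_mem_gammaSubmodule a g.hom x (hN x))

/-- `RΓ_a` is right adjoint to the inclusion of the `a`-torsion objects. -/
theorem BoundedWith.bijective_comp_derivedGammaMap {a : Ideal R}
    {K : DerivedCategory (ModuleCat.{u} R)} (hK : BoundedWith (torsionModules a) K) :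
    Function.Bijective fun f : K ⟶ derivedGamma E a => f ≫ derivedGammaMap E (bot_le : ⊥ ≤ a) := by
  obtain ⟨g, δ, hT⟩ := exists_derivedGamma_triangle E (bot_le : ⊥ ≤ a)
  constructor
  · intro f₁ f₂ hf
    replace hf : (f₁ - f₂) ≫ derivedGammaMap E (bot_le : ⊥ ≤ a) = 0 := by
      rw [Preadditive.sub_comp, sub_eq_zero]
      exact hf
    obtain ⟨u, hu⟩ := Triangle.coyoneda_exact₁ _ hT ((f₁ - f₂)⟦(1 : ℤ)⟧') (by
      refine (Functor.map_comp _ _ _).symm.trans ((congrArg _ hf).trans (Functor.map_zero _ _ _)))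
    have h0 : (f₁ - f₂)⟦(1 : ℤ)⟧' = 0 := hu.trans ((congrArg (· ≫ δ)
      ((hK.shift 1).hom_derivedGammaCone_eq_zero E u)).trans Limits.zero_comp)
    exact sub_eq_zero.mp ((shiftFunctor _ (1 : ℤ)).map_injective
      (h0.trans (Functor.map_zero _ _ _).symm))
  · intro f
    obtain ⟨u, hu⟩ := Triangle.coyoneda_exact₂ _ hT f (hK.hom_derivedGammaCone_eq_zero E _)
    exact ⟨u, hu.symm⟩

end DerivedGamma

section Gorenstein

theorem hom_single_eq_zero_of_extVanishes {N : ModuleCat.{u} R} (i : ℤ)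
    (h : ∀ j : ℕ, i = j → ExtVanishes R N R j)
    (f : (singleFunctor (ModuleCat.{u} R) i).obj N ⟶
      (singleFunctor (ModuleCat.{u} R) 0).obj (ModuleCat.of R R)) : f = 0 := by
  obtain ⟨j, rfl⟩ | hi : (∃ j : ℕ, i = j) ∨ i < 0 := by
    obtain hi | hi := le_or_gt 0 i
    · exact Or.inl ⟨i.toNat, by lia⟩
    · exact Or.inr hi
  · exact (extVanishes_iff_forall_single_hom N R j).mp (h j rfl) f
  · exact t.zero f i 0 hi

variable [IsGorensteinLocalRing R] {n : ℕ} (E : InjectiveResolution (ModuleCat.of R R))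

theorem BoundedWith.hom_single_eq_zero_of_bijectiveSMul
    [IsAdicComplete (maximalIdeal R) R] {x : R} (hx : x ∈ maximalIdeal R)
    {K : DerivedCategory (ModuleCat.{u} R)} (hK : BoundedWith (bijectiveSMulModules x) K)
    (f : K ⟶ (singleFunctor (ModuleCat.{u} R) 0).obj (ModuleCat.of R R)) : f = 0 :=
  hK.hom_eq_zero (fun i N hN f => hom_single_eq_zero_of_extVanishes i
    (fun j _ => extVanishes_of_bijective_smul hx j N hN) f) f

/-- Multiplication by `x` is bijective on the cohomology of the cone of
`RΓ_{(a, x)}(M) ⟶ RΓ_a(M)`. -/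
theorem bijectiveSMulModules_derivedGammaCone {a b : Ideal R} (h : a ≤ b) (x : R)
    (hb : b = a ⊔ Ideal.span {x}) (i : ℤ) :
    bijectiveSMulModules x ((homologyFunctor (ModuleCat.{u} R) i).obj (derivedGammaCone E h)) := by
  let L := (gammaShortComplex h E.cochainComplex).X₃
  refine (bijectiveSMulModules x).prop_of_iso
    ((homologyFunctorFactors (ModuleCat.{u} R) i).symm.app L) ?_
  have h1 (j : ℤ) : IsIso ((x • 𝟙 L : L ⟶ L).f j) := by
    rw [ConcreteCategory.isIso_iff_bijective]
    exact bijective_smul_gammaShortComplex_X₃ h x hb E.cochainComplex j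
  have h2 : IsIso (x • 𝟙 L : L ⟶ L) := HomologicalComplex.Hom.isIso_of_components _
  have h3 : HomologicalComplex.homologyMap (x • 𝟙 L : L ⟶ L) i = x • 𝟙 (L.homology i) := by
    have h4 : HomologicalComplex.homologyMap (x • 𝟙 L : L ⟶ L) i =
        x • HomologicalComplex.homologyMap (𝟙 L) i :=
      ShortComplex.homologyMap_smul
        ((HomologicalComplex.shortComplexFunctor _ _ i).map (𝟙 L)) x
    rw [h4, HomologicalComplex.homologyMap_id]
  have h4 : IsIso (x • 𝟙 (L.homology i)) := by rw [← h3]; infer_instance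
  exact ConcreteCategory.bijective_of_isIso (x • 𝟙 (L.homology i))

theorem boundedWith_bijectiveSMulModules_derivedGammaCone (hn : ringKrullDim R = n)
    {a b : Ideal R} (h : a ≤ b) (x : R) (hb : b = a ⊔ Ideal.span {x}) :
    BoundedWith (bijectiveSMulModules x) (derivedGammaCone E h) where
  isGE := ⟨0, derivedGammaCone_isGE E h⟩
  isLE := by
    obtain ⟨g, δ, hT⟩ := exists_derivedGamma_triangle E h
    have h1 := derivedGamma_isLE E b fun j hj => subsingleton_H_of_dim_lt hn b hj
    have h2 : ((derivedGamma E b)⟦(1 : ℤ)⟧).IsLE n := by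
      have := t.isLE_shift (derivedGamma E b) n 1 (n - 1)
      exact t.isLE_of_le _ (n - 1) n
    exact ⟨n, t.isLE₂ _ (rot_of_distTriang _ hT) n
      (derivedGamma_isLE E a fun j hj => subsingleton_H_of_dim_lt hn a hj) h2⟩
  homology := bijectiveSMulModules_derivedGammaCone E h x hb

end Gorenstein

end LocCoh

/-! ### The morphism `RΓ_a(R) ⟶ R` -/

namespace LocCoh

section Linear

theorem bijective_precomp_iso {D : Type*} [Category* D] {X Y V : D} (e : X ≅ Y) :
    Function.Bijective fun u : Y ⟶ V => e.hom ≫ u :=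
  Function.bijective_iff_has_inverse.mpr
    ⟨fun v => e.inv ≫ v, fun u => by simp, fun v => by simp⟩

theorem bijective_postcomp_iso {D : Type*} [Category* D] {X Y V : D} (e : X ≅ Y) :
    Function.Bijective fun u : V ⟶ X => u ≫ e.hom :=
  Function.bijective_iff_has_inverse.mpr
    ⟨fun v => v ≫ e.inv, fun u => by simp, fun v => by simp⟩

theorem bijective_smul_id_iff_of_iso {S D : Type*} [Ring S] [Category* D] [Preadditive D]
    [Linear S D] {X Y : D} (e : X ≅ Y) : Function.Bijective (fun r : S => r • 𝟙 X) ↔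
    Function.Bijective fun r : S => r • 𝟙 Y := by
  rw [← Function.Bijective.of_comp_iff' (Iso.homCongr e e).bijective]
  refine iff_of_eq (congrArg _ (funext fun r => ?_))
  simp [Iso.homCongr]

theorem bijective_smul_id_iff_of_fullyFaithful {S D D' : Type*} [Ring S] [Category* D]
    [Category* D'] [Preadditive D] [Preadditive D'] [Linear S D] [Linear S D'] (F : D ⥤ D')
    [F.Additive] [F.Linear S] [F.Full] [F.Faithful] {X : D} :
    Function.Bijective (fun r : S => r • 𝟙 (F.obj X)) ↔
    Function.Bijective fun r : S => r • 𝟙 X := by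
  rw [← Function.Bijective.of_comp_iff' (f := (F.map : (X ⟶ X) → _))
    ⟨F.map_injective, F.map_surjective⟩]
  refine iff_of_eq (congrArg _ (funext fun r => ?_))
  simp [Functor.map_smul]

theorem bijective_smul_id_iff_algebraMap {R : Type u} [CommRing R] (N : ModuleCat.{u} R) :
    Function.Bijective (fun r : R => r • 𝟙 N) ↔
      Function.Bijective (algebraMap R (Module.End R N)) := by
  rw [← Function.Bijective.of_comp_iff' (ModuleCat.homEquiv (M := N) (N := N)).bijective]
  rfl

end Linear

section Shift

variable {D : Type*} [Category* D] [HasShift D ℤ] [Preadditive D]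
  [∀ n : ℤ, (shiftFunctor D n).Additive] {X V : D}

/-- Vanishing of `Hom(X, V⟦1⟧)` is equivalent to vanishing of `Hom(X⟦-1⟧, V)`. -/
theorem forall_hom_shift_eq_zero_iff :
    (∀ u : X ⟶ V⟦(1 : ℤ)⟧, u = 0) ↔ ∀ u : X⟦(-1 : ℤ)⟧ ⟶ V, u = 0 := by
  constructor
  · intro h u
    have h1 := eq_zero_of_iso_hom_comp (g := u⟦(1 : ℤ)⟧') (shiftNegShift X (1 : ℤ)).symm (h _)
    exact (shiftFunctor D (1 : ℤ)).map_injective (h1.trans (Functor.map_zero _ _ _).symm)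
  · intro h u
    have h1 := h (u⟦(-1 : ℤ)⟧' ≫ (shiftShiftNeg V (1 : ℤ)).hom)
    rw [Preadditive.IsIso.comp_right_eq_zero] at h1
    exact (shiftFunctor D (-1 : ℤ)).map_injective (h1.trans (Functor.map_zero _ _ _).symm)

end Shift

variable {R : Type u} [CommRing R]

/-- A nonzero `𝔪`-torsion module contains the residue field. -/
theorem exists_injective_residueField [IsLocalRing R] {N : Type u} [AddCommGroup N] [Module R N]
    (hN : ∀ x : N, x ∈ gammaSubmodule (maximalIdeal R) N) [Nontrivial N] :
    ∃ f : R ⧸ maximalIdeal R →ₗ[R] N, Function.Injective f := by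
  classical
  obtain ⟨y, hy⟩ := exists_ne (0 : N)
  have hex := hN y
  have hk := Nat.find_spec hex
  obtain ⟨k, hk'⟩ : ∃ k, Nat.find hex = k + 1 := by
    refine Nat.exists_eq_succ_of_ne_zero fun h0 => hy ?_
    rw [h0] at hk
    simpa using hk 1 (by simp)
  have hmin := Nat.find_min hex (m := k) (by lia)
  push Not at hmin
  obtain ⟨r, hr, hry⟩ := hmin
  have h1 : ∀ s ∈ maximalIdeal R, s • r • y = 0 := fun s hs => by
    rw [smul_smul]
    refine hk _ ?_
    rw [hk', pow_succ']
    exact Ideal.mul_mem_mul hs hr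
  obtain ⟨f, hf⟩ := exists_quotient_hom h1
  refine ⟨f, (injective_iff_map_eq_zero f).mpr fun z hz => ?_⟩
  obtain ⟨s, rfl⟩ := Ideal.Quotient.mk_surjective z
  by_contra hs
  have hu : IsUnit s := by
    by_contra hns
    exact hs (Ideal.Quotient.eq_zero_iff_mem.mpr ((mem_maximalIdeal s).mpr hns))
  have h2 : s • r • y = 0 := by
    rw [← hf, ← map_smul, ← hz, Algebra.smul_def, map_one, mul_one]
    rfl
  exact hry ((hu.smul_eq_zero).mp h2)

/-- Over a Gorenstein local ring of dimension `n`, a nonzero `𝔪`-torsion module `N` has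
`Ext^n(N, R) ≠ 0`. -/
theorem subsingleton_of_extVanishes_dim [IsGorensteinLocalRing R] {n : ℕ}
    (hn : ringKrullDim R = n) {N : ModuleCat.{u} R}
    (hN : torsionModules (maximalIdeal R) N) (h : ExtVanishes R N R n) : Subsingleton N := by
  by_contra hne
  rw [not_subsingleton_iff_nontrivial] at hne
  obtain ⟨f, hf⟩ := exists_injective_residueField hN
  have h1 : ExtVanishes R (R ⧸ maximalIdeal R) R n :=
    ExtVanishes.source_left hf (LinearMap.range f).mkQ_surjective
      (LinearMap.exact_map_mkQ_range f) h (extVanishes_of_dim_lt hn _ (Nat.lt_succ_self n))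
  exact (extVanishes_residueField_iff_ne hn n).mp h1 rfl

variable [HasDerivedCategory.{w} (ModuleCat.{u} R)]

open Pretriangulated DerivedCategory DerivedCategory.TStructure

section Gorenstein

variable [IsGorensteinLocalRing R] {n : ℕ} (E : InjectiveResolution (ModuleCat.of R R))

/-- If objects with invertible action of an element of the maximal ideal have no morphisms to `V`,
then `V` does not distinguish `RΓ_a(R)` and `R`. -/
theorem bijective_precomp_derivedGammaMap (hn : ringKrullDim R = n)
    {V : DerivedCategory (ModuleCat.{u} R)}
    (hV : ∀ x ∈ maximalIdeal R, ∀ K, BoundedWith (bijectiveSMulModules x) K → ∀ f : K ⟶ V, f = 0)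
    {a : Ideal R} (ha : a ≤ maximalIdeal R) :
    Function.Bijective fun u : derivedGamma E ⊥ ⟶ V => derivedGammaMap E (bot_le : ⊥ ≤ a) ≫ u := by
  classical
  obtain ⟨s, rfl⟩ := IsNoetherian.noetherian a
  change Ideal.span (s : Set R) ≤ _ at ha
  change Function.Bijective fun u : derivedGamma E ⊥ ⟶ V =>
    derivedGammaMap E (bot_le : ⊥ ≤ Ideal.span (s : Set R)) ≫ u
  induction s using Finset.induction_on with
  | empty =>
    have h1 (b : Ideal R) (hb : b = ⊥) : Function.Bijective fun u : derivedGamma E ⊥ ⟶ V =>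
        derivedGammaMap E (bot_le : ⊥ ≤ b) ≫ u := by
      subst hb
      have h2 : derivedGammaMap E (bot_le : ⊥ ≤ (⊥ : Ideal R)) = 𝟙 _ := Q.map_id _
      rw [h2]
      exact bijective_precomp_iso (Iso.refl _)
    exact h1 _ (by simp)
  | insert x s _ ih =>
    have hs : Ideal.span ((insert x s : Finset R) : Set R) =
        Ideal.span (s : Set R) ⊔ Ideal.span {x} := by
      rw [Finset.coe_insert, Ideal.span_insert, sup_comm]
    have hle : Ideal.span (s : Set R) ≤ Ideal.span ((insert x s : Finset R) : Set R) := by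
      rw [hs]
      exact le_sup_left
    have hx : x ∈ maximalIdeal R := ha (Ideal.subset_span (by simp))
    obtain ⟨g, δ, hT⟩ := exists_derivedGamma_triangle E hle
    have hC := boundedWith_bijectiveSMulModules_derivedGammaCone E hn hle x hs
    have h1 : Function.Bijective fun u : derivedGamma E (Ideal.span (s : Set R)) ⟶ V =>
        derivedGammaMap E hle ≫ u :=
      ⟨injective_precomp_of_distinguished hT (hV x hx _ hC),
        surjective_precomp_of_distinguished hT (hV x hx _ (hC.shift (-1)))⟩
    have h2 := h1.comp (ih (hle.trans ha))
    convert h2 using 1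
    funext u
    change _ = derivedGammaMap E hle ≫ derivedGammaMap E bot_le ≫ u
    rw [← Category.assoc, derivedGammaMap_comp]

/-- The natural morphism `RΓ_a(R) ⟶ R`. -/
noncomputable def derivedGammaToSelf (a : Ideal R) :
    derivedGamma E a ⟶ (singleFunctor (ModuleCat.{u} R) 0).obj (ModuleCat.of R R) :=
  derivedGammaMap E bot_le ≫ (derivedGammaBotIso E).hom

theorem BoundedWith.bijective_comp_derivedGammaToSelf {a : Ideal R}
    {K : DerivedCategory (ModuleCat.{u} R)} (hK : BoundedWith (torsionModules a) K) :
    Function.Bijective fun f : K ⟶ derivedGamma E a => f ≫ derivedGammaToSelf E a := by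
  have h := (bijective_postcomp_iso (V := K) (derivedGammaBotIso E)).comp
    (hK.bijective_comp_derivedGammaMap E)
  convert h using 1
  funext f
  exact (Category.assoc _ _ _).symm

theorem bijective_precomp_derivedGammaToSelf (hn : ringKrullDim R = n)
    {V : DerivedCategory (ModuleCat.{u} R)}
    (hV : ∀ x ∈ maximalIdeal R, ∀ K, BoundedWith (bijectiveSMulModules x) K → ∀ f : K ⟶ V, f = 0)
    {a : Ideal R} (ha : a ≤ maximalIdeal R) :
    Function.Bijective fun u : (singleFunctor (ModuleCat.{u} R) 0).obj (ModuleCat.of R R) ⟶ V =>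
      derivedGammaToSelf E a ≫ u := by
  have h := (bijective_precomp_derivedGammaMap E hn hV ha).comp
    (bijective_precomp_iso (V := V) (derivedGammaBotIso E))
  convert h using 1
  funext f
  exact Category.assoc _ _ _

/-- Bounded `𝔪`-torsion objects concentrated in degrees less than `n` have no morphisms to `R`. -/
theorem BoundedWith.hom_self_eq_zero_of_isLE (hn : ringKrullDim R = n)
    {K : DerivedCategory (ModuleCat.{u} R)} (hK : BoundedWith (torsionModules (maximalIdeal R)) K)
    (b : ℤ) (hb : b < n) [K.IsLE b]
    (f : K ⟶ (singleFunctor (ModuleCat.{u} R) 0).obj (ModuleCat.of R R)) : f = 0 := by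
  have E : InjectiveResolution (ModuleCat.of R R) := InjectiveResolution.of _
  obtain ⟨g, rfl⟩ := (hK.bijective_comp_derivedGammaToSelf E).2 f
  have hht : (maximalIdeal R).height = n := by
    have := maximalIdeal_height_eq_ringKrullDim (R := R)
    rw [hn] at this
    exact_mod_cast this
  have := derivedGamma_isGE E (maximalIdeal R) (c := n) fun j hj =>
    subsingleton_H_of_lt_height hn hht hj
  have hg : g = 0 := t.zero g b n hb
  rw [hg]
  exact Limits.zero_comp

/-- A weak form of local duality: the top cohomology of a bounded `𝔪`-torsion object in
degrees at most `n` is detected by its morphisms to `R`. -/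
theorem BoundedWith.isLE_of_forall_hom_self_eq_zero (hn : ringKrullDim R = n)
    {K : DerivedCategory (ModuleCat.{u} R)} (hK : BoundedWith (torsionModules (maximalIdeal R)) K)
    [K.IsLE n]
    (h : ∀ f : K ⟶ (singleFunctor (ModuleCat.{u} R) 0).obj (ModuleCat.of R R), f = 0) :
    K.IsLE (n - 1) := by
  have hT := t.triangleLTGE_distinguished n K
  obtain ⟨N, hN, ⟨e⟩⟩ := (hK.truncGE n).exists_iso_single n
  have h1 : ExtVanishes R N R n := by
    rw [extVanishes_iff_forall_single_hom]
    intro f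
    obtain ⟨w, hw⟩ := Triangle.yoneda_exact₃ _ hT (e.hom ≫ f) (h _)
    have hle : (((t.truncLT n).obj K)⟦(1 : ℤ)⟧).IsLE (n - 2) :=
      t.isLE_shift ((t.truncLT n).obj K) (n - 1) 1 (n - 2)
    have hw0 : w = 0 := ((hK.truncLT n).shift 1).hom_self_eq_zero_of_isLE hn (n - 2) (by lia) w
    exact eq_zero_of_iso_hom_comp e
      (hw.trans ((congrArg (_ ≫ ·) hw0).trans Limits.comp_zero))
  have h2 : Limits.IsZero N := ModuleCat.isZero_iff_subsingleton.mpr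
    (subsingleton_of_extVanishes_dim hn hN h1)
  have h3 : Limits.IsZero ((t.truncGE n).obj K) :=
    ((singleFunctor (ModuleCat.{u} R) n).map_isZero h2).of_iso e
  exact (t.isLE_iff_isZero_truncGE_obj (n - 1) n (by lia) K).mpr h3

end Gorenstein

end LocCoh

/-! ### The lowest part of `RΓ_a(R)` and its complement -/

namespace LocCoh

variable {R : Type u} [CommRing R] [HasDerivedCategory.{w} (ModuleCat.{u} R)]

open Pretriangulated DerivedCategory DerivedCategory.TStructure

section Noetherian

variable {M : ModuleCat.{u} R} (E : InjectiveResolution M)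

/-- Above the truncation degree, the truncation of `RΓ_a(M)` computes local cohomology. -/
noncomputable def homologyTruncGEDerivedGammaIso (a : Ideal R) {c j : ℕ} (hj : c < j) :
    (homologyFunctor (ModuleCat.{u} R) j).obj ((t.truncGE (c + 1)).obj (derivedGamma E a)) ≅
      (localCohomologyFunctor a j).obj M :=
  have := isIso_homologyMap_truncGEπ (derivedGamma E a) (i := j) (n := c + 1) (by lia)
  (asIso ((homologyFunctor (ModuleCat.{u} R) j).map
    ((t.truncGEπ (c + 1)).app (derivedGamma E a)))).symm ≪≫ homologyDerivedGammaIso E a j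

end Noetherian

theorem single_hom_shift_self_eq_zero (N : Type u) [AddCommGroup N] [Module R N]
    (u : (singleFunctor (ModuleCat.{u} R) 0).obj (ModuleCat.of R R) ⟶
      ((singleFunctor (ModuleCat.{u} R) 0).obj (ModuleCat.of R N))⟦(1 : ℤ)⟧) : u = 0 := by
  refine forall_hom_shift_eq_zero_iff.mpr (fun v => ?_) u
  have e : ((singleFunctor (ModuleCat.{u} R) 0).obj (ModuleCat.of R R))⟦(-1 : ℤ)⟧ ≅
      (singleFunctor (ModuleCat.{u} R) (1 : ℕ)).obj (ModuleCat.of R R) :=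
    ((singleFunctors (ModuleCat.{u} R)).shiftIso (-1) 1 0 (by simp)).app _
  exact eq_zero_of_iso_hom_comp e.symm
    ((extVanishes_iff_forall_single_hom R N 1).mp (extVanishes_of_projective 0) _)

section Gorenstein

variable [IsGorensteinLocalRing R] {n : ℕ} (E : InjectiveResolution (ModuleCat.of R R))
  {a : Ideal R} {c : ℕ}

theorem isLE_truncGE_derivedGamma (hn : ringKrullDim R = n) (a : Ideal R) (c : ℕ) :
    ((t.truncGE (c + 1)).obj (derivedGamma E a)).IsLE n := by
  have := derivedGamma_isLE E a fun j hj => subsingleton_H_of_dim_lt hn a hj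
  infer_instance

/-- If `a` is locally a cohomological complete intersection, then the part of `RΓ_a(R)` above
the degree `c = ht a` is `𝔪`-torsion. -/
theorem boundedWith_torsionModules_truncGE_derivedGamma (hn : ringKrullDim R = n)
    (ha : IsLocallyCohomologicalCompleteIntersection a) (hc : a.height = c) :
    BoundedWith (torsionModules (maximalIdeal R))
      ((t.truncGE (c + 1)).obj (derivedGamma E a)) where
  isGE := ⟨c + 1, inferInstance⟩
  isLE := ⟨n, isLE_truncGE_derivedGamma E hn a c⟩
  homology i := by
    by_cases hi : (c + 1 : ℤ) ≤ i
    · obtain ⟨j, rfl⟩ : ∃ j : ℕ, i = j := ⟨i.toNat, by lia⟩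
      exact (torsionModules _).prop_of_iso (homologyTruncGEDerivedGammaIso E a (by lia)).symm
        fun m => mem_gammaSubmodule_maximalIdeal ha hc (by lia) m
    · exact (torsionModules _).prop_of_isZero (isZero_of_isGE _ (c + 1) i (by lia))

theorem isLE_truncGE_derivedGamma_iff (hn : ringKrullDim R = n) (a : Ideal R) (c : ℕ) :
    ((t.truncGE (c + 1)).obj (derivedGamma E a)).IsLE (n - 2) ↔
      ∀ i : ℕ, c < i → (i + 1 = n ∨ i = n) → Subsingleton (H a i) := by
  rw [isLE_iff]
  constructor
  · intro h i hi hin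
    exact ModuleCat.isZero_iff_subsingleton.mp
      ((h i (by lia)).of_iso (homologyTruncGEDerivedGammaIso E a hi).symm)
  · intro h i hi
    have := isLE_truncGE_derivedGamma E hn a c
    by_cases hi' : (c + 1 : ℤ) ≤ i
    · obtain ⟨j, rfl⟩ : ∃ j : ℕ, i = j := ⟨i.toNat, by lia⟩
      by_cases hj : j ≤ n
      · exact (ModuleCat.isZero_iff_subsingleton.mpr (h j (by lia) (by lia))).of_iso
          (homologyTruncGEDerivedGammaIso E a (by lia))
      · exact isZero_of_isLE _ n _ (by lia)
    · exact isZero_of_isGE _ (c + 1) i (by lia)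

theorem boundedWith_torsionModules_truncLT_derivedGamma (hn : ringKrullDim R = n)
    (a : Ideal R) (m : ℤ) :
    BoundedWith (torsionModules a) ((t.truncLT m).obj (derivedGamma E a)) :=
  (boundedWith_torsionModules_derivedGamma E a
    fun _ hj => subsingleton_H_of_dim_lt hn a hj).truncLT m

/-- The suspension of the lowest part of `RΓ_a(R)` has no morphisms to `R`, since these factor
through `RΓ_a(R)`, which lives in higher degrees. -/
theorem truncLT_derivedGamma_shift_hom_self_eq_zero (hn : ringKrullDim R = n)
    (hc : a.height = c)
    (u : ((t.truncLT (c + 1)).obj (derivedGamma E a))⟦(1 : ℤ)⟧ ⟶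
      (singleFunctor (ModuleCat.{u} R) 0).obj (ModuleCat.of R R)) : u = 0 := by
  obtain ⟨w, rfl⟩ := (((boundedWith_torsionModules_truncLT_derivedGamma E hn a
    (c + 1)).shift 1).bijective_comp_derivedGammaToSelf E).2 u
  have := derivedGamma_isGE E a fun j hj => subsingleton_H_of_lt_height hn hc hj
  have := t.isLE_shift ((t.truncLT (c + 1)).obj (derivedGamma E a)) c 1 (c - 1)
  have hw : w = 0 := t.zero w (c - 1) c (by lia)
  rw [hw]
  exact Limits.zero_comp

/-- Every endomorphism of the lowest part of `RΓ_a(R)` is determined by the induced morphism to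
`R`. -/
theorem bijective_comp_truncLTι_comp_derivedGammaToSelf (hn : ringKrullDim R = n) (m : ℤ) :
    Function.Bijective fun f : (t.truncLT m).obj (derivedGamma E a) ⟶
        (t.truncLT m).obj (derivedGamma E a) =>
      f ≫ (t.truncLTι m).app (derivedGamma E a) ≫ derivedGammaToSelf E a := by
  have h1 : Function.Bijective fun f : (t.truncLT m).obj (derivedGamma E a) ⟶
        (t.truncLT m).obj (derivedGamma E a) => f ≫ (t.truncLTι m).app (derivedGamma E a) :=
    ⟨fun _ _ h => t.to_truncLT_obj_ext h,
      fun g => ⟨t.liftTruncLT g (m - 1) m (by lia), t.liftTruncLT_ι _ _ _ _⟩⟩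
  have h2 := ((boundedWith_torsionModules_truncLT_derivedGamma E hn a
    m).bijective_comp_derivedGammaToSelf E).comp h1
  convert h2 using 1
  funext f
  exact (Category.assoc _ _ _).symm

section Complete

variable [IsAdicComplete (maximalIdeal R) R]

theorem derivedGamma_shift_hom_self_eq_zero (hn : ringKrullDim R = n)
    (ha : a ≤ maximalIdeal R)
    (u : (derivedGamma E a)⟦(-1 : ℤ)⟧ ⟶
      (singleFunctor (ModuleCat.{u} R) 0).obj (ModuleCat.of R R)) : u = 0 := by
  refine forall_hom_shift_eq_zero_iff.mp (fun v => ?_) u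
  obtain ⟨w, rfl⟩ := (bijective_precomp_derivedGammaToSelf E hn (fun x hx K hK f =>
    forall_hom_shift_eq_zero_iff.mpr
      (fun g => (hK.shift (-1)).hom_single_eq_zero_of_bijectiveSMul hx g) f) ha).2 v
  rw [single_hom_shift_self_eq_zero R w]
  exact Limits.comp_zero

/-- The inclusion of the lowest part of `RΓ_a(R)` induces a bijection on morphisms to `R` if and
only if the complementary part lives in degrees at most `n - 2`. -/
theorem bijective_precomp_truncLTι_iff (hn : ringKrullDim R = n)
    (ha : IsLocallyCohomologicalCompleteIntersection a) (hc : a.height = c)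
    (ham : a ≤ maximalIdeal R) :
    Function.Bijective (fun u : derivedGamma E a ⟶
        (singleFunctor (ModuleCat.{u} R) 0).obj (ModuleCat.of R R) =>
      (t.truncLTι (c + 1)).app (derivedGamma E a) ≫ u) ↔
    ((t.truncGE (c + 1)).obj (derivedGamma E a)).IsLE (n - 2) := by
  have hT := t.triangleLTGE_distinguished (c + 1) (derivedGamma E a)
  have hC := boundedWith_torsionModules_truncGE_derivedGamma E hn ha hc
  have := isLE_truncGE_derivedGamma E hn a c
  constructor
  · intro h
    have h0 := hC.isLE_of_forall_hom_self_eq_zero hn (hom_eq_zero_of_injective_precomp hT h.1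
      (truncLT_derivedGamma_shift_hom_self_eq_zero E hn hc))
    have h1 := t.isLE_shift ((t.truncGE (c + 1)).obj (derivedGamma E a)) (n - 1) (-1) n
    have h2 := (hC.shift (-1)).isLE_of_forall_hom_self_eq_zero hn
      (hom_shift_eq_zero_of_surjective_precomp hT h.2
        (derivedGamma_shift_hom_self_eq_zero E hn ham))
    exact t.isLE_of_shift _ (n - 2) (-1) (n - 1)
  · intro h
    have h1 := t.isLE_shift ((t.truncGE (c + 1)).obj (derivedGamma E a)) (n - 2) (-1) (n - 1)
    exact ⟨injective_precomp_of_distinguished hT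
        (hC.hom_self_eq_zero_of_isLE hn (n - 2) (by lia)),
      surjective_precomp_of_distinguished hT
        ((hC.shift (-1)).hom_self_eq_zero_of_isLE hn (n - 1) (by lia))⟩

/-- `Hom(RΓ_a(R), R)` is free of rank one, generated by the natural morphism. -/
theorem bijective_smul_derivedGammaToSelf (hn : ringKrullDim R = n) (ham : a ≤ maximalIdeal R) :
    Function.Bijective fun r : R => r • derivedGammaToSelf E a := by
  have h1 : Function.Bijective fun r : R =>
      r • 𝟙 ((singleFunctor (ModuleCat.{u} R) 0).obj (ModuleCat.of R R)) := by
    rw [bijective_smul_id_iff_of_fullyFaithful, bijective_smul_id_iff_algebraMap]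
    refine ⟨fun r s h => ?_, fun f => ⟨f (1 : R), LinearMap.ext_ring ?_⟩⟩
    · simpa using LinearMap.congr_fun h (1 : R)
    · simp
  have h2 := (bijective_precomp_derivedGammaToSelf E hn (fun x hx K hK f =>
    hK.hom_single_eq_zero_of_bijectiveSMul hx f) ham).comp h1
  convert h2 using 1
  funext r
  simp

/-- The endomorphisms of `H^c_a(R)` are those of the lowest part of `RΓ_a(R)`, so the homothety map
can be read off from restricting morphisms `RΓ_a(R) ⟶ R` to that part. -/
theorem bijective_algebraMap_iff (hn : ringKrullDim R = n) (hc : a.height = c)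
    (ham : a ≤ maximalIdeal R) :
    Function.Bijective (algebraMap R (Module.End R (H a c))) ↔
    Function.Bijective (fun u : derivedGamma E a ⟶
        (singleFunctor (ModuleCat.{u} R) 0).obj (ModuleCat.of R R) =>
      (t.truncLTι (c + 1)).app (derivedGamma E a) ≫ u) := by
  have := derivedGamma_isGE E a fun j hj => subsingleton_H_of_lt_height hn hc hj
  obtain ⟨N, ⟨e⟩⟩ := ((t.truncLT (c + 1)).obj
    (derivedGamma E a)).exists_iso_singleFunctor_obj_of_isGE_of_isLE c
  have := isIso_homologyMap_truncLTι (derivedGamma E a) (i := c) (n := c + 1) (by lia)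
  let e' : N ≅ H a c := ((singleFunctorCompHomologyFunctorIso (ModuleCat.{u} R) c).app N).symm ≪≫
    (homologyFunctor (ModuleCat.{u} R) c).mapIso e.symm ≪≫
    asIso ((homologyFunctor (ModuleCat.{u} R) c).map
      ((t.truncLTι (c + 1)).app (derivedGamma E a))) ≪≫ homologyDerivedGammaIso E a c
  rw [← bijective_smul_id_iff_algebraMap, ← bijective_smul_id_iff_of_iso e',
    ← bijective_smul_id_iff_of_fullyFaithful (singleFunctor (ModuleCat.{u} R) c),
    ← bijective_smul_id_iff_of_iso e,
    ← Function.Bijective.of_comp_iff'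
      (bijective_comp_truncLTι_comp_derivedGammaToSelf E (a := a) hn (c + 1)),
    ← Function.Bijective.of_comp_iff _ (bijective_smul_derivedGammaToSelf E hn ham)]
  refine iff_of_eq (congrArg _ (funext fun r => ?_))
  simp

end Complete

end Gorenstein

end LocCoh

theorem theorem1p1 {R : Type*} [CommRing R] [LocCoh.IsGorensteinLocalRing R]
    [IsAdicComplete (IsLocalRing.maximalIdeal R) R]
    (n : ℕ) (hn : ringKrullDim R = n)
    (I : Ideal R) (c : ℕ) (hc : I.height = c)
    (hI : LocCoh.IsLocallyCohomologicalCompleteIntersection I) :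
    Function.Bijective (algebraMap R (Module.End R (LocCoh.H I c))) ↔
      ∀ i : ℕ, c < i → (i + 1 = n ∨ i = n) → Subsingleton (LocCoh.H I i) := by
  have hIm : I ≤ maximalIdeal R := le_maximalIdeal fun h => by simp [h] at hc
  let := HasDerivedCategory.standard (ModuleCat R)
  let E := InjectiveResolution.of (ModuleCat.of R R)
  exact (LocCoh.bijective_algebraMap_iff E hn hc hIm).trans
    ((LocCoh.bijective_precomp_truncLTι_iff E hn hI hc hIm).trans
      (LocCoh.isLE_truncGE_derivedGamma_iff E hn I c))
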